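/- Let $R$ be a Banach ring, i.e. a commutative ring with $1$ with a complete norm satisfying $|ab|\le C|a||b|$ for some constant $C>0$. Let $\mathrm{Ban}_R$ be the category of Banach $R$-modules (complete normed $R$-modules $M$ with $\|am\|\le C_M|a|\|m\|$ for some constant $C_M>0$) and bounded $R$-linear maps. It carries the completed projective tensor product $M\widehat\otimes_R N$, the separated completion of $M\otimes_R N$ for the seminorm $\|x\|=\inf\{\sum_i\|m_i\|\|n_i\| : x=\sum_i m_i\otimes n_i\}$, the internal Hom $\underline{\mathrm{Hom}}(M,N)$ of bounded $R$-linear maps with the operator norm, and the dual $M^\vee=\underline{\mathrm{Hom}}(M,R)$. Extend these to the category $\mathrm{Ind}(\mathrm{Ban}_R)$ of ind-objects by $``\mathrm{colim}_i"V_i\,\widehat\otimes_R\,``\mathrm{colim}_j"W_j=``\mathrm{colim}_{(i,j)}"\,V_i\widehat\otimes_R W_j$ and, for $W\in\mathrm{Ban}_R$, $\underline{\mathrm{Hom}}(W,``\mathrm{colim}_i"V_i)=``\mathrm{colim}_i"\,\underline{\mathrm{Hom}}(W,V_i)$. An object $V$ of $\mathrm{Ind}(\mathrm{Ban}_R)$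 is called nuclear if for every Banach $R$-module $W$ the natural morphism $W^\vee\widehat\otimes_R V\to\underline{\mathrm{Hom}}(W,V)$, induced by $\alpha\otimes v\mapsto(w\mapsto\alpha(w)v)$, is an isomorphism. A morphism $f$ is called strict if the canonical morphism $\mathrm{coim}(f)\to\mathrm{im}(f)$ is an isomorphism, where $\mathrm{im}(f)=\ker(\mathrm{coker} f)$ and $\mathrm{coim}(f)=\mathrm{coker}(\ker f)$. An object $F$ is called flat if the functor $(-)\widehat\otimes_R F$ preserves strict monomorphisms. Lemma. Every nuclear object of $\mathrm{Ind}(\mathrm{Ban}_R)$ is flat in $\mathrm{Ind}(\mathrm{Ban}_R)$. -/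

import Mathlib

open CategoryTheory CategoryTheory.Limits
open scoped TensorProduct

noncomputable section

/-- A Banach ring: a commutative unital ring with a complete norm for which multiplication is
bounded, `|a b| ≤ C |a| |b|` for some constant `C > 0`. Neither `C = 1` nor `|1| = 1` is required. -/
class BanachRing.{u} (R : Type u) extends NormedAddCommGroup R, CommRing R where
  complete : CompleteSpace R
  exists_norm_mul_le : ∃ C : ℝ, 0 < C ∧ ∀ a b : R, ‖a * b‖ ≤ C * ‖a‖ * ‖b‖

/-- A Banach module over a Banach ring `R`. -/
structure BanMod.{u} (R : Type u) [BanachRing R] : Type (u + 1) where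
  carrier : Type u
  [normed : NormedAddCommGroup carrier]
  [module : Module R carrier]
  [complete : CompleteSpace carrier]
  exists_norm_smul_le : ∃ C : ℝ, 0 < C ∧ ∀ (a : R) (m : carrier), ‖a • m‖ ≤ C * ‖a‖ * ‖m‖

namespace BanMod

universe u

variable {R : Type u} [BanachRing R]

instance : CoeSort (BanMod R) (Type u) := ⟨BanMod.carrier⟩

attribute [instance] BanMod.normed BanMod.module BanMod.complete

/-- The ring `R` as a Banach module over itself. -/
abbrev unit (R : Type u) [BanachRing R] : BanMod R :=
  haveI : CompleteSpace R := BanachRing.complete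
  { carrier := R
    exists_norm_smul_le := BanachRing.exists_norm_mul_le }

instance continuousConstSMul (M : BanMod R) : ContinuousConstSMul R M where
  continuous_const_smul a := by
    obtain ⟨C, -, h⟩ := M.exists_norm_smul_le
    exact AddMonoidHomClass.continuous_of_bound (DistribSMul.toAddMonoidHom M a) (C * ‖a‖) (h a)

/-! ### Bounded linear maps and the internal Hom -/

/-- The `R`-module of bounded `R`-linear maps. -/
def bounded (M N : BanMod R) : Submodule R (M →ₗ[R] N) where
  carrier := {f | ∃ C : ℝ, ∀ m, ‖f m‖ ≤ C * ‖m‖}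
  zero_mem' := ⟨0, by simp⟩
  add_mem' := by
    rintro f g ⟨C, hC⟩ ⟨D, hD⟩
    refine ⟨C + D, fun m => ?_⟩
    rw [add_mul]
    exact (norm_add_le _ _).trans (add_le_add (hC m) (hD m))
  smul_mem' := by
    rintro a f ⟨C, hC⟩
    obtain ⟨D, hD, h⟩ := N.exists_norm_smul_le
    refine ⟨D * ‖a‖ * C, fun m => (h a (f m)).trans ?_⟩
    rw [mul_assoc (D * ‖a‖)]
    exact mul_le_mul_of_nonneg_left (hC m) (by positivity)

/-- The type of bounded `R`-linear maps `M → N`. -/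
def HomSpace (M N : BanMod R) : Type u := bounded M N

namespace HomSpace

variable {M N P : BanMod R}

instance : AddCommGroup (HomSpace M N) := inferInstanceAs (AddCommGroup (bounded M N))

instance : Module R (HomSpace M N) := inferInstanceAs (Module R (bounded M N))

instance : FunLike (HomSpace M N) M N where
  coe f := f.1
  coe_injective _ _ h := Subtype.ext (DFunLike.coe_injective h)

instance : AddMonoidHomClass (HomSpace M N) M N where
  map_add f := f.1.map_add
  map_zero f := f.1.map_zero

/-- A bounded linear map from a linear map and a bound. -/
def mk (f : M →ₗ[R] N) (h : ∃ C : ℝ, ∀ m, ‖f m‖ ≤ C * ‖m‖) : HomSpace M N := ⟨f, h⟩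

@[simp] theorem mk_apply (f : M →ₗ[R] N) (h : ∃ C : ℝ, ∀ m, ‖f m‖ ≤ C * ‖m‖) (m : M) :
    mk f h m = f m := rfl

@[ext] theorem ext {f g : HomSpace M N} (h : ∀ m, f m = g m) : f = g := DFunLike.ext _ _ h

@[simp] theorem add_apply (f g : HomSpace M N) (m : M) : (f + g) m = f m + g m := rfl

@[simp] theorem neg_apply (f : HomSpace M N) (m : M) : (-f) m = -f m := rfl

@[simp] theorem sub_apply (f g : HomSpace M N) (m : M) : (f - g) m = f m - g m := rfl

@[simp] theorem zero_apply (m : M) : (0 : HomSpace M N) m = 0 := rfl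

@[simp] theorem smul_apply (a : R) (f : HomSpace M N) (m : M) : (a • f) m = a • f m := rfl

theorem map_smul (f : HomSpace M N) (a : R) (m : M) : f (a • m) = a • f m := f.1.map_smul a m

theorem exists_bound (f : HomSpace M N) : ∃ C : ℝ, 0 ≤ C ∧ ∀ m, ‖f m‖ ≤ C * ‖m‖ := by
  obtain ⟨C, hC⟩ := f.2
  exact ⟨max C 0, le_max_right _ _, fun m => (hC m).trans
    (mul_le_mul_of_nonneg_right (le_max_left _ _) (norm_nonneg _))⟩

theorem continuous (f : HomSpace M N) : Continuous f := by
  obtain ⟨C, hC⟩ := f.2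
  exact AddMonoidHomClass.continuous_of_bound f C hC

/-- The operator norm `sup ‖f m‖ / ‖m‖` (the term `m = 0` contributes `0 / 0 = 0`). -/
instance : Norm (HomSpace M N) := ⟨fun f => ⨆ m : M, ‖f m‖ / ‖m‖⟩

theorem norm_def (f : HomSpace M N) : ‖f‖ = ⨆ m : M, ‖f m‖ / ‖m‖ := rfl

theorem norm_le {f : HomSpace M N} {c : ℝ} (hc : 0 ≤ c) (h : ∀ m, ‖f m‖ ≤ c * ‖m‖) : ‖f‖ ≤ c :=
  ciSup_le fun m => div_le_of_le_mul₀ (norm_nonneg _) hc (h m)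

theorem nonneg (f : HomSpace M N) : 0 ≤ ‖f‖ := Real.iSup_nonneg fun _ => by positivity

theorem le_norm (f : HomSpace M N) (m : M) : ‖f m‖ ≤ ‖f‖ * ‖m‖ := by
  obtain ⟨C, hC, h⟩ := f.exists_bound
  rcases eq_or_ne m 0 with rfl | hm
  · simp
  · have hb : BddAbove (Set.range fun m : M => ‖f m‖ / ‖m‖) := by
      refine ⟨C, ?_⟩
      rintro _ ⟨x, rfl⟩
      exact div_le_of_le_mul₀ (norm_nonneg _) hC (h x)
    exact (div_le_iff₀ (norm_pos_iff.2 hm)).1 (le_ciSup hb m)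

instance : NormedAddCommGroup (HomSpace M N) :=
  AddGroupNorm.toNormedAddCommGroup
    { toFun := fun f => ‖f‖
      map_zero' := le_antisymm (norm_le le_rfl (by simp)) (nonneg _)
      add_le' := fun f g => norm_le (add_nonneg (nonneg f) (nonneg g)) fun m => by
        rw [add_mul]
        exact (norm_add_le _ _).trans (add_le_add (le_norm f m) (le_norm g m))
      neg' := fun f => by simp [norm_def]
      eq_zero_of_map_eq_zero' := fun f hf => by
        ext m
        have h := le_norm f m
        have hf' : ‖f‖ = 0 := hf
        rw [hf', zero_mul] at h
        simpa using h }

instance : CompleteSpace (HomSpace M N) := by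
  refine Metric.complete_of_cauchySeq_tendsto fun u hu => ?_
  rw [Metric.cauchySeq_iff] at hu
  simp only [dist_eq_norm] at hu
  have hsub : ∀ (f g : HomSpace M N) (m : M), ‖f m - g m‖ ≤ ‖f - g‖ * ‖m‖ :=
    fun f g m => le_norm (f - g) m
  have hpt : ∀ m : M, ∃ y : N, Filter.Tendsto (fun n => u n m) Filter.atTop (nhds y) := by
    intro m
    refine cauchySeq_tendsto_of_complete (Metric.cauchySeq_iff.2 fun ε hε => ?_)
    obtain ⟨K, hK⟩ := hu (ε / (‖m‖ + 1)) (by positivity)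
    refine ⟨K, fun n hn k hk => ?_⟩
    rw [dist_eq_norm]
    refine (hsub _ _ m).trans_lt ?_
    calc ‖u n - u k‖ * ‖m‖ ≤ ε / (‖m‖ + 1) * ‖m‖ :=
          mul_le_mul_of_nonneg_right (hK n hn k hk).le (norm_nonneg _)
      _ < ε := by
          rw [div_mul_eq_mul_div, div_lt_iff₀ (by positivity)]
          nlinarith
  choose g hg using hpt
  have hest : ∀ ε > 0, ∃ K, ∀ n ≥ K, ∀ m, ‖u n m - g m‖ ≤ ε * ‖m‖ := by
    intro ε hε
    obtain ⟨K, hK⟩ := hu ε hε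
    refine ⟨K, fun n hn m => ?_⟩
    refine le_of_tendsto ((tendsto_const_nhds.sub (hg m)).norm) ?_
    filter_upwards [Filter.eventually_ge_atTop K] with k hk
    exact (hsub _ _ m).trans (mul_le_mul_of_nonneg_right (hK n hn k hk).le (norm_nonneg _))
  let G : M →ₗ[R] N :=
    { toFun := g
      map_add' := fun x y => tendsto_nhds_unique (hg (x + y))
        (((hg x).add (hg y)).congr fun n => (map_add (u n) x y).symm)
      map_smul' := fun a x => tendsto_nhds_unique (hg (a • x))
        (((hg x).const_smul a).congr fun n => (map_smul (u n) a x).symm) }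
  have hG : ∃ C : ℝ, ∀ m, ‖G m‖ ≤ C * ‖m‖ := by
    obtain ⟨K, hK⟩ := hest 1 one_pos
    refine ⟨‖u K‖ + 1, fun m => ?_⟩
    have h1 := hK K le_rfl m
    have h2 := le_norm (u K) m
    have h3 : ‖g m‖ ≤ ‖u K m‖ + ‖u K m - g m‖ := by
      simpa using norm_sub_le (u K m) (u K m - g m)
    change ‖g m‖ ≤ _
    linarith
  refine ⟨mk G hG, Metric.tendsto_atTop.2 fun ε hε => ?_⟩
  obtain ⟨K, hK⟩ := hest (ε / 2) (by positivity)
  refine ⟨K, fun n hn => ?_⟩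
  rw [dist_eq_norm]
  exact (norm_le (by positivity) (hK n hn)).trans_lt (by linarith)

/-- The identity. -/
def id (M : BanMod R) : HomSpace M M := mk LinearMap.id ⟨1, fun m => by simp⟩

/-- Composition. -/
def comp (g : HomSpace N P) (f : HomSpace M N) : HomSpace M P :=
  mk (g.1.comp f.1) (by
    obtain ⟨C, _, hC⟩ := f.exists_bound
    obtain ⟨D, hD, hD'⟩ := g.exists_bound
    refine ⟨D * C, fun m => (hD' (f m)).trans ?_⟩
    rw [mul_assoc]
    exact mul_le_mul_of_nonneg_left (hC m) hD)

@[simp] theorem id_apply (m : M) : id M m = m := rfl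

@[simp] theorem comp_apply (g : HomSpace N P) (f : HomSpace M N) (m : M) : comp g f m = g (f m) :=
  rfl

end HomSpace

/-- The category of Banach modules over `R` with bounded `R`-linear maps. -/
instance category : Category (BanMod R) where
  Hom M N := HomSpace M N
  id M := HomSpace.id M
  comp f g := HomSpace.comp g f

instance concreteCategory : ConcreteCategory (BanMod R) (fun M N => HomSpace M N) where
  hom f := f
  ofHom f := f

/-- Boundedness of the scalar multiplication on the space of bounded maps. -/
theorem HomSpace.exists_norm_smul_le (M N : BanMod R) :
    ∃ C : ℝ, 0 < C ∧ ∀ (a : R) (f : HomSpace M N), ‖a • f‖ ≤ C * ‖a‖ * ‖f‖ := by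
  obtain ⟨C, hC, h⟩ := N.exists_norm_smul_le
  refine ⟨C, hC, fun a f => norm_le (by positivity) fun m => (h a (f m)).trans ?_⟩
  rw [mul_assoc (C * ‖a‖)]
  exact mul_le_mul_of_nonneg_left (le_norm f m) (by positivity)

/-- The internal Hom: bounded linear maps with the operator norm. -/
abbrev homObj (M N : BanMod R) : BanMod R where
  carrier := HomSpace M N
  exists_norm_smul_le := HomSpace.exists_norm_smul_le M N

/-- Postcomposition with a bounded map. -/
def homMap (M : BanMod R) {N P : BanMod R} (g : HomSpace N P) :
    HomSpace (homObj M N) (homObj M P) :=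
  HomSpace.mk
    { toFun := fun f : HomSpace M N => HomSpace.comp g f
      map_add' := fun f₁ f₂ : HomSpace M N => HomSpace.ext fun m => map_add g (f₁ m) (f₂ m)
      map_smul' := fun a (f : HomSpace M N) => HomSpace.ext fun m => g.map_smul a (f m) }
    ⟨‖g‖, fun f : HomSpace M N => HomSpace.norm_le (mul_nonneg g.nonneg f.nonneg) fun m => by
      refine (HomSpace.le_norm g (f m)).trans ?_
      rw [mul_assoc]
      exact mul_le_mul_of_nonneg_left (HomSpace.le_norm f m) (norm_nonneg _)⟩

/-- The functor `N ↦ Hom(M, N)`. -/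
abbrev ihom (M : BanMod R) : BanMod R ⥤ BanMod R where
  obj N := homObj M N
  map g := homMap M g

/-- The dual `Hom(M, R)`. -/
abbrev dual (M : BanMod R) : BanMod R := homObj M (unit R)

/-! ### The completed projective tensor product -/

/-- The algebraic tensor product, carrying the projective seminorm. -/
def AlgTensor (M N : BanMod R) : Type u := M ⊗[R] N

namespace AlgTensor

variable {M N : BanMod R}

instance : AddCommGroup (AlgTensor M N) := inferInstanceAs (AddCommGroup (M ⊗[R] N))

instance : Module R (AlgTensor M N) := inferInstanceAs (Module R (M ⊗[R] N))

/-- Pure tensors, as a bilinear map. -/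
def tmul (M N : BanMod R) : M →ₗ[R] N →ₗ[R] AlgTensor M N := TensorProduct.mk R M N

/-- The numbers `∑ ‖mᵢ‖ ‖nᵢ‖` for the finite presentations `x = ∑ mᵢ ⊗ nᵢ`. -/
def costs (x : AlgTensor M N) : Set ℝ :=
  {r | ∃ l : List (M × N), x = (l.map fun p => tmul M N p.1 p.2).sum ∧
    r = (l.map fun p => ‖p.1‖ * ‖p.2‖).sum}

theorem costs_nonneg {x : AlgTensor M N} {r : ℝ} (hr : r ∈ costs x) : 0 ≤ r := by
  obtain ⟨l, -, rfl⟩ := hr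
  refine List.sum_nonneg fun a ha => ?_
  obtain ⟨p, -, rfl⟩ := List.mem_map.1 ha
  positivity

theorem costs_bddBelow (x : AlgTensor M N) : BddBelow (costs x) := ⟨0, fun _ => costs_nonneg⟩

theorem costs_add {x y : AlgTensor M N} {r s : ℝ} (hr : r ∈ costs x) (hs : s ∈ costs y) :
    r + s ∈ costs (x + y) := by
  obtain ⟨l, rfl, rfl⟩ := hr
  obtain ⟨k, rfl, rfl⟩ := hs
  exact ⟨l ++ k, by simp, by simp⟩

theorem costs_tmul (m : M) (n : N) : ‖m‖ * ‖n‖ ∈ costs (tmul M N m n) := ⟨[(m, n)], by simp, by simp⟩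

theorem costs_nonempty (x : AlgTensor M N) : (costs x).Nonempty := by
  refine TensorProduct.induction_on (R := R) (M := M) (N := N)
    (motive := fun x => (costs (M := M) (N := N) x).Nonempty) x ⟨0, [], rfl, rfl⟩
    (fun m n => ⟨_, costs_tmul m n⟩) ?_
  rintro x y ⟨r, hr⟩ ⟨s, hs⟩
  exact ⟨_, costs_add hr hs⟩

theorem costs_neg {x : AlgTensor M N} {r : ℝ} (hr : r ∈ costs x) : r ∈ costs (-x) := by
  obtain ⟨l, rfl, rfl⟩ := hr
  refine ⟨l.map fun p => (-p.1, p.2), ?_, by simp [Function.comp_def]⟩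
  induction l with
  | nil => simp
  | cons p l ih =>
    simp only [List.map_cons, List.sum_cons, neg_add, ih, map_neg, LinearMap.neg_apply]

/-- The projective seminorm `inf ∑ ‖mᵢ‖ ‖nᵢ‖`. -/
instance : Norm (AlgTensor M N) := ⟨fun x => sInf (costs x)⟩

theorem norm_def (x : AlgTensor M N) : ‖x‖ = sInf (costs x) := rfl

theorem norm_le_of_mem {x : AlgTensor M N} {r : ℝ} (hr : r ∈ costs x) : ‖x‖ ≤ r :=
  csInf_le (costs_bddBelow x) hr

theorem exists_cost_lt (x : AlgTensor M N) {ε : ℝ} (hε : 0 < ε) : ∃ r ∈ costs x, r < ‖x‖ + ε :=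
  exists_lt_of_csInf_lt (costs_nonempty x) (lt_add_of_pos_right _ hε)

instance : SeminormedAddCommGroup (AlgTensor M N) :=
  AddGroupSeminorm.toSeminormedAddCommGroup
    { toFun := fun x => ‖x‖
      map_zero' := le_antisymm (norm_le_of_mem ⟨[], rfl, rfl⟩)
        (Real.sInf_nonneg fun _ => costs_nonneg)
      add_le' := fun x y => le_of_forall_pos_le_add fun ε hε => by
        obtain ⟨r, hr, hr'⟩ := exists_cost_lt x (half_pos hε)
        obtain ⟨s, hs, hs'⟩ := exists_cost_lt y (half_pos hε)
        have := norm_le_of_mem (costs_add hr hs)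
        linarith
      neg' := fun x => by
        have h : ∀ y : AlgTensor M N, costs y ⊆ costs (-y) := fun y r => costs_neg
        rw [norm_def, norm_def, (h x).antisymm (by simpa using h (-x))] }

theorem norm_tmul_le (m : M) (n : N) : ‖tmul M N m n‖ ≤ ‖m‖ * ‖n‖ := norm_le_of_mem (costs_tmul m n)

/-- A linear map that is bounded on pure tensors is bounded. -/
theorem bound_of_tmul {E : Type*} [SeminormedAddCommGroup E] (f : AlgTensor M N →+ E) {C : ℝ}
    (hC : 0 ≤ C) (h : ∀ m n, ‖f (tmul M N m n)‖ ≤ C * (‖m‖ * ‖n‖)) (x : AlgTensor M N) :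
    ‖f x‖ ≤ C * ‖x‖ := by
  have key : ∀ r ∈ costs x, ‖f x‖ ≤ C * r := by
    rintro r ⟨l, rfl, rfl⟩
    induction l with
    | nil => simp
    | cons p l ih =>
      simp only [List.map_cons, List.sum_cons, map_add, mul_add]
      exact (norm_add_le _ _).trans (add_le_add (h _ _) ih)
  refine le_of_forall_pos_le_add fun ε hε => ?_
  obtain ⟨r, hr, hr'⟩ := exists_cost_lt x (ε := ε / (C + 1)) (by positivity)
  calc ‖f x‖ ≤ C * r := key r hr
    _ ≤ C * (‖x‖ + ε / (C + 1)) := mul_le_mul_of_nonneg_left hr'.le hC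
    _ ≤ C * ‖x‖ + ε := by
      rw [mul_add]
      gcongr
      rw [mul_div_assoc', div_le_iff₀ (by positivity)]
      nlinarith

theorem exists_norm_smul_le (M N : BanMod R) :
    ∃ C : ℝ, 0 < C ∧ ∀ (a : R) (x : AlgTensor M N), ‖a • x‖ ≤ C * ‖a‖ * ‖x‖ := by
  obtain ⟨C, hC, h⟩ := M.exists_norm_smul_le
  refine ⟨C, hC, fun a x => bound_of_tmul (DistribSMul.toAddMonoidHom (AlgTensor M N) a)
    (by positivity) (fun m n => ?_) x⟩
  have e : a • tmul M N m n = tmul M N (a • m) n := by simp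
  change ‖a • tmul M N m n‖ ≤ _
  rw [e, ← mul_assoc]
  exact (norm_tmul_le _ _).trans (mul_le_mul_of_nonneg_right (h a m) (norm_nonneg _))

instance : UniformContinuousConstSMul R (AlgTensor M N) where
  uniformContinuous_const_smul a := by
    obtain ⟨C, -, h⟩ := exists_norm_smul_le M N
    exact AddMonoidHomClass.uniformContinuous_of_bound
      (DistribSMul.toAddMonoidHom (AlgTensor M N) a) (C * ‖a‖) (h a)

end AlgTensor

/-- The completed projective tensor product: the separated completion of the algebraic tensor
product for the projective seminorm. -/
def tensorObj (M N : BanMod R) : BanMod R where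
  carrier := UniformSpace.Completion (AlgTensor M N)
  exists_norm_smul_le := by
    obtain ⟨C, hC, h⟩ := AlgTensor.exists_norm_smul_le M N
    refine ⟨C, hC, fun a x => ?_⟩
    induction x using UniformSpace.Completion.induction_on with
    | hp => exact isClosed_le (continuous_const_smul a).norm (continuous_const.mul continuous_norm)
    | ih x =>
      rw [← UniformSpace.Completion.coe_smul, UniformSpace.Completion.norm_coe,
        UniformSpace.Completion.norm_coe]
      exact h a x

section Tensor

variable {M N P : BanMod R}

/-- The pure tensor `m ⊗ n` in the completed tensor product. -/
def tmul (m : M) (n : N) : tensorObj M N :=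
  ((AlgTensor.tmul M N m n : AlgTensor M N) : UniformSpace.Completion (AlgTensor M N))

theorem norm_tmul_le (m : M) (n : N) : ‖tmul m n‖ ≤ ‖m‖ * ‖n‖ :=
  (UniformSpace.Completion.norm_coe _).trans_le (AlgTensor.norm_tmul_le m n)

/-- Pure tensors in the completed tensor product, as a bilinear map. -/
def tmulₗ (M N : BanMod R) : M →ₗ[R] N →ₗ[R] tensorObj M N :=
  LinearMap.mk₂ R tmul
    (fun m m' n => by simp only [tmul, map_add, LinearMap.add_apply, UniformSpace.Completion.coe_add]; rfl)
    (fun a m n => by simp only [tmul, map_smul, LinearMap.smul_apply, UniformSpace.Completion.coe_smul]; rfl)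
    (fun m n n' => by simp only [tmul, map_add, UniformSpace.Completion.coe_add]; rfl)
    (fun a m n => by simp only [tmul, map_smul, UniformSpace.Completion.coe_smul]; rfl)

/-- The bounded map on the completed tensor product induced by a bounded bilinear map. -/
def tensorLift (b : M →ₗ[R] N →ₗ[R] P) (hb : ∃ C : ℝ, 0 ≤ C ∧ ∀ m n, ‖b m n‖ ≤ C * (‖m‖ * ‖n‖)) :
    HomSpace (tensorObj M N) P :=
  let f : AlgTensor M N →ₗ[R] P := TensorProduct.lift b
  let F : NormedAddGroupHom (AlgTensor M N) P :=
    { toFun := f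
      map_add' := f.map_add
      bound' := by
        obtain ⟨C, hC, h⟩ := hb
        exact ⟨C, AlgTensor.bound_of_tmul f.toAddMonoidHom hC h⟩ }
  HomSpace.mk
    { toFun := F.extension
      map_add' := map_add F.extension
      map_smul' := fun a x => by
        refine UniformSpace.Completion.induction_on
          (p := fun x => F.extension (a • x) = a • F.extension x) x ?_ fun x => ?_
        · exact isClosed_eq (F.extension.continuous.comp (continuous_const_smul a))
            ((continuous_const_smul a).comp F.extension.continuous)
        · rw [← UniformSpace.Completion.coe_smul, NormedAddGroupHom.extension_coe,
            NormedAddGroupHom.extension_coe]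
          exact f.map_smul a x }
    ⟨‖F.extension‖, F.extension.le_opNorm⟩

@[simp] theorem tensorLift_tmul (b : M →ₗ[R] N →ₗ[R] P)
    (hb : ∃ C : ℝ, 0 ≤ C ∧ ∀ m n, ‖b m n‖ ≤ C * (‖m‖ * ‖n‖)) (m : M) (n : N) :
    tensorLift b hb (tmul m n) = b m n :=
  NormedAddGroupHom.extension_coe _ _

/-- Bounded maps out of the completed tensor product are determined by their values on pure
tensors. -/
theorem tensor_hom_ext {f g : HomSpace (tensorObj M N) P} (h : ∀ m n, f (tmul m n) = g (tmul m n)) :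
    f = g := by
  ext x
  refine UniformSpace.Completion.induction_on (p := fun x => f x = g x) x
    (isClosed_eq f.continuous g.continuous) fun x => ?_
  refine TensorProduct.induction_on (R := R) (M := M) (N := N)
    (motive := fun x => f (UniformSpace.Completion.coe' (α := AlgTensor M N) x) =
      g (UniformSpace.Completion.coe' (α := AlgTensor M N) x)) x ?_ h ?_
  · exact (map_zero f).trans (map_zero g).symm
  · intro x y hx hy
    exact (congrArg f (UniformSpace.Completion.coe_add (α := AlgTensor M N) x y)).trans <|
      (map_add f _ _).trans <| (congrArg₂ (· + ·) hx hy).trans <| (map_add g _ _).symm.trans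
        (congrArg g (UniformSpace.Completion.coe_add (α := AlgTensor M N) x y).symm)

end Tensor

/-- The map `f ⊗ g` on completed tensor products. -/
def tensorMap {M M' N N' : BanMod R} (f : HomSpace M M') (g : HomSpace N N') :
    HomSpace (tensorObj M N) (tensorObj M' N') :=
  tensorLift ((tmulₗ M' N').compl₁₂ f.1 g.1) ⟨‖f‖ * ‖g‖, by positivity, fun m n => by
    refine (norm_tmul_le (f m) (g n)).trans ?_
    calc ‖f m‖ * ‖g n‖ ≤ (‖f‖ * ‖m‖) * (‖g‖ * ‖n‖) :=
          mul_le_mul (f.le_norm m) (g.le_norm n) (norm_nonneg _) (by positivity)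
      _ = ‖f‖ * ‖g‖ * (‖m‖ * ‖n‖) := by ring⟩

@[simp] theorem tensorMap_tmul {M M' N N' : BanMod R} (f : HomSpace M M') (g : HomSpace N N')
    (m : M) (n : N) : tensorMap f g (tmul m n) = tmul (f m) (g n) :=
  tensorLift_tmul _ _ m n

theorem tensorMap_id (M N : BanMod R) :
    tensorMap (HomSpace.id M) (HomSpace.id N) = HomSpace.id (tensorObj M N) :=
  tensor_hom_ext fun m n => by simp

theorem tensorMap_comp {M M' M'' N N' N'' : BanMod R} (f : HomSpace M M') (f' : HomSpace M' M'')
    (g : HomSpace N N') (g' : HomSpace N' N'') :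
    tensorMap (HomSpace.comp f' f) (HomSpace.comp g' g) =
      HomSpace.comp (tensorMap f' g') (tensorMap f g) :=
  tensor_hom_ext fun m n => by simp

/-- The completed projective tensor product as a bifunctor. -/
abbrev tensor (R : Type u) [BanachRing R] : BanMod R ⥤ BanMod R ⥤ BanMod R where
  obj M :=
    { obj := fun N => tensorObj M N
      map := fun g => tensorMap (HomSpace.id M) g
      map_id := fun N => tensorMap_id M N
      map_comp := fun g g' => tensorMap_comp (HomSpace.id M) (HomSpace.id M) g g' }
  map f :=
    { app := fun N => tensorMap f (HomSpace.id N)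
      naturality := fun N N' g =>
        (tensorMap_comp (HomSpace.id _) f g (HomSpace.id N')).symm.trans
          (tensorMap_comp f (HomSpace.id _) (HomSpace.id N) g) }
  map_id M := NatTrans.ext (funext fun N => tensorMap_id M N)
  map_comp f f' := NatTrans.ext (funext fun N =>
    tensorMap_comp f f' (HomSpace.id N) (HomSpace.id N))

/-- The rank one map `m ↦ α(m) n`. -/
def rankOne {M N : BanMod R} (α : HomSpace M (unit R)) (n : N) : HomSpace M N :=
  HomSpace.mk ((LinearMap.toSpanSingleton R N n).comp α.1) (by
    obtain ⟨C, hC, h⟩ := N.exists_norm_smul_le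
    refine ⟨C * ‖α‖ * ‖n‖, fun m => (h (α m) n).trans ?_⟩
    calc C * ‖α m‖ * ‖n‖ ≤ C * (‖α‖ * ‖m‖) * ‖n‖ := by gcongr; exact α.le_norm m
      _ = C * ‖α‖ * ‖n‖ * ‖m‖ := by ring)

theorem rankOne_apply {M N : BanMod R} (α : HomSpace M (unit R)) (n : N) (m : M) :
    rankOne α n m = (show R from α m) • n := rfl

/-- The canonical map `M^∨ ⊗ N → Hom(M, N)`, `α ⊗ n ↦ (m ↦ α(m) n)`. -/
def dualTensorHom (M N : BanMod R) : HomSpace (tensorObj (dual M) N) (homObj M N) :=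
  tensorLift
    (LinearMap.mk₂ R (fun (α : HomSpace M (unit R)) (n : N) => (rankOne α n : HomSpace M N))
      (fun (α β : HomSpace M (unit R)) n => HomSpace.ext fun m =>
        add_smul (show R from α m) (show R from β m) n)
      (fun a (α : HomSpace M (unit R)) n => HomSpace.ext fun m =>
        mul_smul a (show R from α m) n)
      (fun (α : HomSpace M (unit R)) n n' => HomSpace.ext fun m =>
        smul_add (show R from α m) n n')
      (fun a (α : HomSpace M (unit R)) n => HomSpace.ext fun m =>
        smul_comm (show R from α m) a n))
    (by
      obtain ⟨C, hC, h⟩ := N.exists_norm_smul_le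
      refine ⟨C, hC.le, fun (α : HomSpace M (unit R)) n => HomSpace.norm_le ?_ fun m => ?_⟩
      · exact mul_nonneg hC.le (mul_nonneg α.nonneg (norm_nonneg _))
      · refine (h (α m) n).trans ?_
        calc C * ‖α m‖ * ‖n‖ ≤ C * (‖α‖ * ‖m‖) * ‖n‖ := by gcongr; exact α.le_norm m
          _ = C * (‖α‖ * ‖n‖) * ‖m‖ := by ring)

theorem dualTensorHom_tmul (M N : BanMod R) (α : HomSpace M (unit R)) (n : N) :
    dualTensorHom M N (tmul (M := dual M) α n) = rankOne α n :=
  tensorLift_tmul (M := dual M) (P := homObj M N) _ _ α n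

/-- The canonical map `M^∨ ⊗ N → Hom(M, N)` as a natural transformation in `N`. -/
def dualTensorHomNat (M : BanMod R) : (tensor R).obj (dual M) ⟶ ihom M where
  app N := dualTensorHom M N
  naturality N N' g := tensor_hom_ext fun (α : HomSpace M (unit R)) n => by
    change dualTensorHom M N' (tensorMap (HomSpace.id (dual M)) g (tmul (M := dual M) α n)) =
      homMap M g (dualTensorHom M N (tmul (M := dual M) α n))
    rw [tensorMap_tmul, dualTensorHom_tmul, HomSpace.id_apply, dualTensorHom_tmul]
    exact HomSpace.ext fun m => (HomSpace.map_smul g (show R from α m) n).symm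

/-! ### Zero object, kernels and cokernels -/

instance preadditive : Preadditive (BanMod R) where
  homGroup M N := inferInstanceAs (AddCommGroup (HomSpace M N))
  add_comp _ _ _ _ _ g := HomSpace.ext fun _ => map_add (show HomSpace _ _ from g) _ _
  comp_add _ _ _ _ _ _ := rfl

instance hasZeroObject : HasZeroObject (BanMod R) := by
  let Z : BanMod R :=
    { carrier := PUnit
      exists_norm_smul_le := ⟨1, one_pos, fun a m => by simp⟩ }
  have hZ : 𝟙 Z = 0 := HomSpace.ext fun m => rfl
  exact ⟨Z, (IsZero.iff_id_eq_zero Z).2 hZ⟩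

instance hasKernels : HasKernels (BanMod R) where
  has_limit {M N} f := by
    let f' : HomSpace M N := f
    have hc : IsClosed (LinearMap.ker f'.1 : Set M) := by
      have : (LinearMap.ker f'.1 : Set M) = f' ⁻¹' {0} := by ext; rfl
      rw [this]
      exact isClosed_singleton.preimage f'.continuous
    have : CompleteSpace (LinearMap.ker f'.1) := hc.completeSpace_coe
    let K : BanMod R :=
      { carrier := LinearMap.ker f'.1
        exists_norm_smul_le := by
          obtain ⟨C, hC, h⟩ := M.exists_norm_smul_le
          exact ⟨C, hC, fun a m => h a m⟩ }
    let ι : K ⟶ M := HomSpace.mk (M := K) (LinearMap.ker f'.1).subtype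
      ⟨1, fun m => (one_mul ‖m‖).ge⟩
    have w : ι ≫ f = 0 := HomSpace.ext fun m => m.2
    refine ⟨⟨⟨KernelFork.ofι ι w, ?_⟩⟩⟩
    refine KernelFork.IsLimit.ofι ι w
      (fun {T} (g : HomSpace T M) hg => HomSpace.mk (N := K)
        (g.1.codRestrict (LinearMap.ker f'.1) fun t => DFunLike.congr_fun (F := HomSpace T N) hg t)
        g.2)
      (fun {T} g hg => rfl) ?_
    intro T g hg l hl
    refine HomSpace.ext fun t => Subtype.ext ?_
    exact DFunLike.congr_fun (F := HomSpace T M) hl t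

instance hasCokernels : HasCokernels (BanMod R) where
  has_colimit {M N} f := by
    let f' : HomSpace M N := f
    let S : Submodule R N := (LinearMap.range f'.1).topologicalClosure
    have : IsClosed (S : Set N) := Submodule.isClosed_topologicalClosure _
    let Q : BanMod R :=
      { carrier := N ⧸ S
        exists_norm_smul_le := by
          obtain ⟨C, hC, h⟩ := N.exists_norm_smul_le
          refine ⟨C, hC, fun a x => le_of_forall_pos_le_add fun ε hε => ?_⟩
          obtain ⟨n, rfl, hn⟩ := Submodule.Quotient.norm_mk_lt x
            (ε := ε / (C * ‖a‖ + 1)) (by positivity)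
          calc ‖a • (Submodule.Quotient.mk n : N ⧸ S)‖
              ≤ ‖a • n‖ := Submodule.Quotient.norm_mk_le S (a • n)
            _ ≤ C * ‖a‖ * ‖n‖ := h a n
            _ ≤ C * ‖a‖ * (‖(Submodule.Quotient.mk n : N ⧸ S)‖ + ε / (C * ‖a‖ + 1)) :=
              mul_le_mul_of_nonneg_left hn.le (by positivity)
            _ ≤ C * ‖a‖ * ‖(Submodule.Quotient.mk n : N ⧸ S)‖ + ε := by
              rw [mul_add]
              gcongr
              rw [mul_div_assoc', div_le_iff₀ (by positivity)]
              nlinarith }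
    let π : N ⟶ Q := HomSpace.mk (N := Q) S.mkQ
      ⟨1, fun n => (Submodule.Quotient.norm_mk_le S n).trans (one_mul ‖n‖).ge⟩
    have w : f ≫ π = 0 := HomSpace.ext fun m => (Submodule.Quotient.mk_eq_zero S).2
      (Submodule.le_topologicalClosure _ ⟨m, rfl⟩)
    refine ⟨⟨⟨CokernelCofork.ofπ π w, ?_⟩⟩⟩
    have hS : ∀ {T : BanMod R} (g : HomSpace N T), f ≫ g = 0 → S ≤ LinearMap.ker g.1 := by
      intro T g hg
      refine Submodule.topologicalClosure_minimal _ ?_ ?_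
      · rintro _ ⟨m, rfl⟩
        exact DFunLike.congr_fun (F := HomSpace M T) hg m
      · have : (LinearMap.ker g.1 : Set N) = g ⁻¹' {0} := by ext; rfl
        rw [this]
        exact isClosed_singleton.preimage g.continuous
    refine CokernelCofork.IsColimit.ofπ π w
      (fun {T} (g : HomSpace N T) hg => HomSpace.mk (M := Q) (S.liftQ g.1 (hS g hg)) ?_)
      (fun {T} g hg => rfl) ?_
    · obtain ⟨C, hC, h⟩ := g.exists_bound
      refine ⟨C, fun x => le_of_forall_pos_le_add fun ε hε => ?_⟩
      obtain ⟨n, rfl, hn⟩ := Submodule.Quotient.norm_mk_lt (S := S) x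
        (ε := ε / (C + 1)) (by positivity)
      calc ‖g n‖ ≤ C * ‖n‖ := h n
        _ ≤ C * (‖(Submodule.Quotient.mk n : N ⧸ S)‖ + ε / (C + 1)) :=
          mul_le_mul_of_nonneg_left hn.le hC
        _ ≤ C * ‖(Submodule.Quotient.mk n : N ⧸ S)‖ + ε := by
          rw [mul_add]
          gcongr
          rw [mul_div_assoc', div_le_iff₀ (by positivity)]
          nlinarith
    · intro T g hg l hl
      refine HomSpace.ext fun x => ?_
      obtain ⟨n, rfl⟩ := Submodule.Quotient.mk_surjective S x
      exact DFunLike.congr_fun (F := HomSpace N T) hl n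

instance hasEqualizers : HasEqualizers (BanMod R) := Preadditive.hasEqualizers_of_hasKernels

instance hasCoequalizers : HasCoequalizers (BanMod R) := Preadditive.hasCoequalizers_of_hasCokernels

end BanMod

/-! ### Extension of functors to ind-objects -/

namespace IndExt

universe u v u' v'

variable {C : Type u} [Category.{v} C] {H : Type u'} [Category.{v'} H]
  [HasFilteredColimitsOfSize.{v, v} H]

/-- Left Kan extensions along `C ⥤ Ind C` exist and are pointwise: the value at `"colim" Vᵢ` is
`colim F(Vᵢ)`. -/
instance hasPointwiseLan (F : C ⥤ H) : (Ind.yoneda (C := C)).HasPointwiseLeftKanExtension F := by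
  intro V
  let e : CostructuredArrow Ind.yoneda V ≌ CostructuredArrow yoneda ((Ind.inclusion C).obj V) :=
    (CostructuredArrow.post Ind.yoneda (Ind.inclusion C) V).asEquivalence.trans
      (CostructuredArrow.mapNatIso Ind.yonedaCompInclusion)
  exact Functor.Final.hasColimit_of_comp (V.presentation.toCostructuredArrow ⋙ e.inverse)

instance hasFilteredColimits_functor {D : Type*} [Category* D] :
    HasFilteredColimitsOfSize.{v, v} (D ⥤ H) where
  HasColimitsOfShape _ _ _ := inferInstance

/-- The extension of a functor `F : C ⥤ H` to `Ind C`, given by `"colim" Vᵢ ↦ colim F(Vᵢ)`: the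
left Kan extension along `C ⥤ Ind C`. -/
abbrev extend : (C ⥤ H) ⥤ (Ind C ⥤ H) := (Ind.yoneda (C := C)).lan

/-- The extension restricts to the functor one started with. -/
def extendIso (F : C ⥤ H) : F ≅ Ind.yoneda ⋙ extend.obj F :=
  letI η : F ⟶ Ind.yoneda ⋙ extend.obj F := (Ind.yoneda (C := C)).leftKanExtensionUnit F
  have : IsIso η :=
    Functor.LeftExtension.IsPointwiseLeftKanExtension.isIso_hom
      (Functor.isPointwiseLeftKanExtensionLeftKanExtensionUnit Ind.yoneda F)
  asIso η

/-- The extension of an endofunctor of `C` to `Ind C`, given by `"colim" Vᵢ ↦ "colim" F(Vᵢ)`. -/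
abbrev extendEndo : (C ⥤ C) ⥤ (Ind C ⥤ Ind C) :=
  (Functor.whiskeringRight C C (Ind C)).obj Ind.yoneda ⋙ extend

/-- The extension of a bifunctor `t` on `C` to `Ind C`, given by
`("colim" Vᵢ, "colim" Wⱼ) ↦ "colim" t(Vᵢ, Wⱼ)`. -/
abbrev extendBi (t : C ⥤ C ⥤ C) : Ind C ⥤ Ind C ⥤ Ind C := extend.obj (t ⋙ extendEndo)

/-- For `A` in `C`, the functor `extendBi t A` is the extension of `t A`. -/
def extendBiIso (t : C ⥤ C ⥤ C) (A : C) :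
    (extendBi t).obj (Ind.yoneda.obj A) ≅ extendEndo.obj (t.obj A) :=
  ((extendIso (t ⋙ extendEndo)).app A).symm

open scoped ZeroObject in
instance hasZeroObject [HasZeroObject C] : HasZeroObject (Ind C) := by
  have hi : IsInitial (Ind.yoneda.obj (0 : C)) :=
    IsInitial.isInitialObj Ind.yoneda _ HasZeroObject.zeroIsInitial
  have ht : IsTerminal (Ind.yoneda.obj (0 : C)) :=
    IsTerminal.isTerminalObj Ind.yoneda _ HasZeroObject.zeroIsTerminal
  exact ⟨Ind.yoneda.obj 0, fun Y => ⟨⟨⟨hi.to Y⟩, fun f => hi.hom_ext _ _⟩⟩,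
    fun Y => ⟨⟨⟨ht.from Y⟩, fun f => ht.hom_ext _ _⟩⟩⟩

end IndExt

/-! ### Ind-Banach modules -/

/-- A strict monomorphism: a monomorphism whose comparison `coim f ⟶ im f` is an isomorphism, where
`im f = ker (coker f)` and `coim f = coker (ker f)`. -/
def IsStrictMono.{v, u} {E : Type u} [Category.{v} E] [HasZeroMorphisms E] [HasKernels E]
    [HasCokernels E] {X Y : E} (f : X ⟶ Y) : Prop :=
  Mono f ∧ IsIso (Abelian.coimageImageComparison f)

namespace IndBan

universe u

variable {R : Type u} [BanachRing R]

instance hasZeroMorphisms : HasZeroMorphisms (Ind (BanMod R)) :=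
  HasZeroObject.zeroMorphismsOfZeroObject

/-- The completed projective tensor product of ind-Banach modules,
`"colim" Vᵢ ⊗ "colim" Wⱼ = "colim" (Vᵢ ⊗ Wⱼ)`. -/
abbrev tensor (R : Type u) [BanachRing R] :
    Ind (BanMod R) ⥤ Ind (BanMod R) ⥤ Ind (BanMod R) :=
  IndExt.extendBi (BanMod.tensor R)

/-- The internal Hom from a Banach module to ind-Banach modules,
`Hom(W, "colim" Vᵢ) = "colim" Hom(W, Vᵢ)`. -/
abbrev ihom (W : BanMod R) : Ind (BanMod R) ⥤ Ind (BanMod R) :=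
  IndExt.extendEndo.obj (BanMod.ihom W)

/-- The natural morphism `W^∨ ⊗ V ⟶ Hom(W, V)`, for a Banach module `W`, natural in the
ind-Banach module `V`. -/
def dualTensorHom (W : BanMod R) :
    (tensor R).obj (Ind.yoneda.obj (BanMod.dual W)) ⟶ ihom W :=
  (IndExt.extendBiIso (BanMod.tensor R) (BanMod.dual W)).hom ≫
    IndExt.extendEndo.map (BanMod.dualTensorHomNat W)

/-- An ind-Banach module `V` is nuclear if `W^∨ ⊗ V ⟶ Hom(W, V)` is an isomorphism for every
Banach module `W`. -/
def IsNuclear (V : Ind (BanMod R)) : Prop :=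
  ∀ W : BanMod R, IsIso ((dualTensorHom W).app V)

/-- An ind-Banach module `F` is flat if the functor `(-) ⊗ F` preserves strict monomorphisms. -/
def IsFlat (F : Ind (BanMod R)) : Prop :=
  ∀ ⦃X Y : Ind (BanMod R)⦄ (f : X ⟶ Y), IsStrictMono f →
    IsStrictMono (((tensor R).map f).app F)

end IndBan

end

/-! Strict monomorphisms are the same as kernels (`IsKernelMap.iff_isStrictMono`), so the claim is
that `(-) ⊗ V` preserves kernels. Every morphism of ind-objects is a filtered colimit of morphisms
of Banach modules, `(-) ⊗ V` commutes with these colimits, and filtered colimits in `Ind` are exact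
enough to preserve kernels. This reduces the claim to a kernel `f : X → Y` of Banach modules
(`IndExt.isKernelMap_map`).

Write `V = "colim" Dⱼ`. Nuclearity is needed only for `W = Dⱼ`: the identity of `Dⱼ`, seen in
`Hom(Dⱼ, V)`, comes from `Dⱼ^∨ ⊗ V`. So some transition map `Dⱼ → Dₖ` is given by a tensor `t ∈ Dⱼ^∨
⊗ Dₖ` (`IsNuclear.exists_dualTensorHom_eq`).

The map `X ⊗ Dⱼ → Y ⊗ Dⱼ` need not be a kernel. Let `Kⱼ` be the kernel of its cokernel. Contracting
with `α ∈ Dⱼ^∨` sends `Kⱼ ⊆ Y ⊗ Dⱼ` into `Y`, and in fact into `X`, because `X` is a kernel.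
Contracting along `t` therefore gives a map `Kⱼ → X ⊗ Dₖ` over the transition maps
(`BanMod.exists_lift_of_tensor`). Hence the systems `X ⊗ Dⱼ` and `Kⱼ` interleave and have the same
colimit, and `"colim" Kⱼ → Y ⊗ V` is a kernel (`IndExt.isKernelMap_lim_map`). -/

noncomputable section

/-! ### Kernels and strict monomorphisms -/

/-- A morphism which is a kernel of some morphism. -/
def IsKernelMap.{v, u} {E : Type u} [Category.{v} E] [HasZeroMorphisms E] {X Y : E}
    (f : X ⟶ Y) : Prop :=
  ∃ (Z : E) (g : Y ⟶ Z) (w : f ≫ g = 0), Nonempty (IsLimit (KernelFork.ofι f w))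

namespace IsKernelMap

universe v u v' u'

variable {E : Type u} [Category.{v} E] [HasZeroMorphisms E]

theorem of_arrow_iso {X Y X' Y' : E} {f : X ⟶ Y} {f' : X' ⟶ Y'} (hf : IsKernelMap f)
    (e : Arrow.mk f ≅ Arrow.mk f') : IsKernelMap f' := by
  obtain ⟨Z, g, w, ⟨h⟩⟩ := hf
  let l : X ≅ X' := Arrow.leftFunc.mapIso e
  let r : Y ≅ Y' := Arrow.rightFunc.mapIso e
  have hw : l.hom ≫ f' = f ≫ r.hom := e.hom.w
  have hw' : l.inv ≫ f = f' ≫ r.inv := e.inv.w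
  refine ⟨Z, r.inv ≫ g, by rw [← reassoc_of% hw', w, comp_zero], ⟨?_⟩⟩
  have : Mono f := mono_of_isLimit_fork h
  refine KernelFork.IsLimit.ofι _ _
    (fun k hk => h.lift (KernelFork.ofι (k ≫ r.inv) (by simpa using hk)) ≫ l.hom) ?_ ?_
  · intro T k hk
    have := h.fac (KernelFork.ofι (k ≫ r.inv) (by simpa using hk)) WalkingParallelPair.zero
    simp only [Fork.ofι_π_app] at this
    rw [Category.assoc, hw, reassoc_of% this]
    simp
  · intro T k hk m hm
    rw [← cancel_mono l.inv, ← cancel_mono f]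
    have := h.fac (KernelFork.ofι (k ≫ r.inv) (by simpa using hk)) WalkingParallelPair.zero
    simp only [Fork.ofι_π_app] at this
    simp only [Category.assoc, Iso.hom_inv_id, Category.comp_id]
    rw [this, hw', reassoc_of% hm]

theorem kernel_ι {Y Z : E} (g : Y ⟶ Z) [HasKernel g] : IsKernelMap (kernel.ι g) :=
  ⟨Z, g, kernel.condition g, ⟨kernelIsKernel g⟩⟩

/-- A kernel is a kernel of its cokernel. -/
theorem isIso_factorThruImage [HasKernels E] [HasCokernels E] {X Y : E} {f : X ⟶ Y}
    (hf : IsKernelMap f) : IsIso (Abelian.factorThruImage f) := by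
  obtain ⟨Z, g, w, ⟨h⟩⟩ := hf
  have : Mono f := mono_of_isLimit_fork h
  -- `g` factors through `cokernel.π f`, so it kills the image, which therefore factors through `f`.
  have hk : Abelian.image.ι f ≫ g = 0 := by
    rw [← cokernel.π_desc f g w, reassoc_of% kernel.condition (cokernel.π f), zero_comp]
  have hl := h.fac (KernelFork.ofι (Abelian.image.ι f) hk) WalkingParallelPair.zero
  simp only [Fork.ofι_π_app] at hl
  refine ⟨h.lift (KernelFork.ofι (Abelian.image.ι f) hk), ?_, ?_⟩
  · rw [← cancel_mono f, Category.assoc, hl, Abelian.image.fac, Category.id_comp]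
  · rw [← cancel_mono (Abelian.image.ι f), Category.assoc, Abelian.image.fac, hl,
      Category.id_comp]

/-- A monomorphism has zero kernel, so its coimage projection is invertible. The comparison map is
then invertible exactly when `X ⟶ ker (coker f)` is. -/
theorem iff_isStrictMono [HasKernels E] [HasCokernels E] {X Y : E} {f : X ⟶ Y} :
    IsKernelMap f ↔ IsStrictMono f := by
  have key : ∀ [Mono f], IsIso (Abelian.coimage.π f) := by
    intro _
    have h0 : kernel.ι f = 0 := by rw [← cancel_mono f]; simp
    refine ⟨cokernel.desc _ (𝟙 X) (by rw [h0, zero_comp]), by simp, ?_⟩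
    rw [← cancel_epi (Abelian.coimage.π f)]
    simp
  have hfac : Abelian.coimage.π f ≫ Abelian.coimageImageComparison f =
      Abelian.factorThruImage f := by
    rw [← cancel_mono (Abelian.image.ι f)]
    simp
  constructor
  · intro hf
    have hi := hf.isIso_factorThruImage
    have hm : Mono f := by
      obtain ⟨Z, g, w, ⟨h⟩⟩ := hf
      exact mono_of_isLimit_fork h
    have := key
    rw [← hfac] at hi
    exact ⟨hm, IsIso.of_isIso_comp_left (Abelian.coimage.π f) _⟩
  · rintro ⟨hm, hi⟩
    have := key
    have hi' : IsIso (Abelian.factorThruImage f) := by rw [← hfac]; infer_instance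
    refine (kernel_ι (cokernel.π f)).of_arrow_iso (Arrow.isoMk
      (asIso (Abelian.factorThruImage f)).symm (Iso.refl _) ?_)
    simp

theorem map {E' : Type u'} [Category.{v'} E'] [HasZeroMorphisms E'] {X Y : E} {f : X ⟶ Y}
    (hf : IsKernelMap f) (G : E ⥤ E') [G.PreservesZeroMorphisms]
    [PreservesLimitsOfShape WalkingParallelPair G] : IsKernelMap (G.map f) := by
  obtain ⟨Z, g, w, ⟨h⟩⟩ := hf
  refine ⟨G.obj Z, G.map g, by rw [← G.map_comp, w, G.map_zero], ⟨?_⟩⟩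
  exact KernelFork.mapIsLimit _ h G

/-- A kernel is a kernel of every cokernel of it. -/
def isLimitOfIsColimit {X Y Z Q : E} {f : X ⟶ Y} {g : Y ⟶ Z} {w : f ≫ g = 0}
    (h : IsLimit (KernelFork.ofι f w)) {q : Y ⟶ Q} {wq : f ≫ q = 0}
    (hq : IsColimit (CokernelCofork.ofπ q wq)) : IsLimit (KernelFork.ofι f wq) :=
  have hk {T : E} (k : T ⟶ Y) (hk : k ≫ q = 0) : k ≫ g = 0 := by
    have h1 := hq.fac (CokernelCofork.ofπ g w) WalkingParallelPair.one
    simp only [Cofork.ofπ_ι_app] at h1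
    rw [← h1, reassoc_of% hk, zero_comp]
  KernelFork.IsLimit.ofι _ _ (fun k hk' => h.lift (KernelFork.ofι k (hk k hk')))
    (fun k hk' => h.fac (KernelFork.ofι k (hk k hk')) WalkingParallelPair.zero)
    (fun k hk' m hm => Fork.IsLimit.hom_ext h
      (hm.trans (h.fac (KernelFork.ofι k (hk k hk')) WalkingParallelPair.zero).symm))

/-- A natural transformation which is pointwise a kernel is a kernel. -/
theorem of_app [HasEqualizers E] [HasCoequalizers E] {I : Type u'} [Category.{v'} I] {A B : I ⥤ E}
    (m : A ⟶ B) (hm : ∀ i, IsKernelMap (m.app i)) : IsKernelMap m := by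
  -- The morphisms of which the `m.app i` are kernels need not be natural in `i`; the cokernels are,
  -- and they are computed pointwise.
  refine ⟨_, cokernel.π m, cokernel.condition m, ⟨evaluationJointlyReflectsLimits _ fun i => ?_⟩⟩
  have hi := hm i
  refine (KernelFork.isLimitMapConeEquiv _ ((evaluation I E).obj i)).symm ?_
  exact isLimitOfIsColimit hi.choose_spec.choose_spec.choose_spec.some
    (CokernelCofork.mapIsColimit _ (cokernelIsCokernel m) ((evaluation I E).obj i))
    (wq := congr_app (cokernel.condition m) i)

end IsKernelMap

/-! ### Filtered colimits and extended functors on ind-objects -/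

namespace IndExt

universe v u v' u'

variable {C : Type u} [Category.{v} C]

/-- `Hom(P, -)` on `Ind C` is evaluation at `P` of the underlying presheaf; both the inclusion into
presheaves and evaluation preserve filtered colimits. -/
instance isFinitelyPresentable_yoneda (P : C) :
    IsFinitelyPresentable.{v} (Ind.yoneda.obj P : Ind C) := by
  let i : (Ind.inclusion C).obj (Ind.yoneda.obj P) ≅ yoneda.obj P := Ind.yonedaCompInclusion.app P
  let e : Ind.inclusion C ⋙ (evaluation Cᵒᵖ (Type v)).obj (.op P) ≅
      coyoneda.obj (.op (Ind.yoneda.obj P : Ind C)) :=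
    NatIso.ofComponents (fun V => (yonedaEquiv.symm.trans ((i.homCongr (Iso.refl _)).symm.trans
      (Ind.inclusion.fullyFaithful.homEquiv (X := Ind.yoneda.obj P) (Y := V)).symm)).toIso)
      (fun {V W} f => by
        ext x
        apply (Ind.inclusion C).map_injective
        simp [Functor.FullyFaithful.homEquiv, yonedaEquiv_symm_naturality_right])
  rw [isFinitelyPresentable_iff_preservesFilteredColimits]
  exact ⟨fun J _ _ => preservesColimitsOfShape_of_natIso e⟩

section

variable {I : Type v} [SmallCategory I] {D : I ⥤ C} {c : Cocone (D ⋙ Ind.yoneda)}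

/-- The functor to the category of objects of `C` over an ind-object given by a cocone. -/
def toCostructuredArrow (c : Cocone (D ⋙ Ind.yoneda)) : I ⥤ CostructuredArrow Ind.yoneda c.pt :=
  c.toCostructuredArrow ⋙ CostructuredArrow.pre D Ind.yoneda c.pt

/-- Finite presentability of the objects of `C` gives both finality conditions. Hence the pointwise
Kan extension can be computed along any presentation `D`. -/
theorem final_toCostructuredArrow [IsFiltered I] (hc : IsColimit c) : (toCostructuredArrow c).Final := by
  refine Functor.final_of_exists_of_isFiltered _ (fun d => ?_) (fun {d i} s s' => ?_)
  · obtain ⟨i, p, hp⟩ := IsFinitelyPresentable.exists_hom_of_isColimit hc d.hom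
    exact ⟨i, ⟨CostructuredArrow.homMk (Ind.yoneda.preimage p) ((congrArg (· ≫ c.ι.app i) (Ind.yoneda.map_preimage p)).trans hp)⟩⟩
  · have hs := CostructuredArrow.w s
    have hs' := CostructuredArrow.w s'
    obtain ⟨k, a, b, h⟩ := IsFinitelyPresentable.exists_eq_of_isColimit hc
      (Ind.yoneda.map s.left) (Ind.yoneda.map s'.left) (hs.trans hs'.symm)
    -- The two transition maps `a, b : i ⟶ k` may differ, so they are coequalized.
    refine ⟨IsFiltered.coeq a b, a ≫ IsFiltered.coeqHom a b, ?_⟩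
    ext
    apply Ind.yoneda.map_injective
    have h2 := congrArg (· ≫ (D ⋙ Ind.yoneda).map (IsFiltered.coeqHom a b)) h
    simp only [Category.assoc, ← Functor.map_comp, ← IsFiltered.coeq_condition a b] at h2
    exact (Ind.yoneda.map_comp _ _).trans (h2.trans (Ind.yoneda.map_comp _ _).symm)

variable {H : Type u'} [Category.{v'} H] [HasFilteredColimitsOfSize.{v, v} H]

/-- The cocone exhibiting the value of the extension of `F` at `"colim" Dᵢ` as `colim F(Dᵢ)`. -/
def extendCocone (F : C ⥤ H) (c : Cocone (D ⋙ Ind.yoneda)) : Cocone (D ⋙ F) where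
  pt := (extend.obj F).obj c.pt
  ι :=
    { app i := (extendIso F).hom.app (D.obj i) ≫ (extend.obj F).map (c.ι.app i)
      naturality i j f := by
        have h := c.w f
        simp only [Functor.comp_map] at h ⊢
        simp [← h] }

/-- The extension of `F` sends `"colim" Dᵢ` to `colim F(Dᵢ)`. -/
def isColimitExtendCocone [IsFiltered I] (F : C ⥤ H) (hc : IsColimit c) : IsColimit (extendCocone F c) :=
  have := final_toCostructuredArrow hc
  (Functor.Final.isColimitWhiskerEquiv (toCostructuredArrow c) _).symm
    (Functor.isPointwiseLeftKanExtensionLeftKanExtensionUnit Ind.yoneda F c.pt)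

theorem extendCocone_ι_map {F G : C ⥤ H} (τ : F ⟶ G) (i : I) :
    (extendCocone F c).ι.app i ≫ (extend.map τ).app c.pt =
      τ.app (D.obj i) ≫ (extendCocone G c).ι.app i := by
  have h := NatTrans.congr_app (((Ind.yoneda (C := C)).lanUnit (H := H)).naturality τ) (D.obj i)
  have h' : (extendIso F).hom.app (D.obj i) ≫ (extend.map τ).app (Ind.yoneda.obj (D.obj i)) =
    τ.app (D.obj i) ≫ (extendIso G).hom.app (D.obj i) := h.symm
  exact (Category.assoc _ _ _).trans <|
    (congrArg (_ ≫ ·) ((extend.map τ).naturality (c.ι.app i))).trans <|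
    (Category.assoc _ _ _).symm.trans <| (congrArg (· ≫ _) h').trans (Category.assoc _ _ _)

/-- Diagrams of objects of `C` suffice, since morphisms of `Ind C` are presented levelwise by such
diagrams. -/
theorem preservesColimit_extend [IsFiltered I] (F : C ⥤ H) (hc : IsColimit c) :
    PreservesColimit (D ⋙ Ind.yoneda) (extend.obj F) := by
  refine preservesColimit_of_preserves_colimit_cocone hc ?_
  exact IsColimit.precomposeHomEquiv (Functor.isoWhiskerLeft D (extendIso F)) _
    (isColimitExtendCocone F hc)

/-- The value of the extension of an endofunctor `F` at `"colim" Dᵢ` is `"colim" F(Dᵢ)`, naturally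
in `F`. -/
def extendEndoObjIso [IsFiltered I] (hc : IsColimit c) :
    extendEndo ⋙ (evaluation (Ind C) (Ind C)).obj c.pt ≅
      (Functor.whiskeringLeft I C C).obj D ⋙ Ind.lim I :=
  NatIso.ofComponents (fun F => (isColimitExtendCocone (F ⋙ Ind.yoneda) hc).coconePointUniqueUpToIso
    (colimit.isColimit (D ⋙ F ⋙ Ind.yoneda))) (by
    intro F G τ
    refine (isColimitExtendCocone (F ⋙ Ind.yoneda) hc).hom_ext fun i => ?_
    have h := extendCocone_ι_map (c := c) (Functor.whiskerRight τ Ind.yoneda) i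
    have h1 := (isColimitExtendCocone (F ⋙ Ind.yoneda) hc).comp_coconePointUniqueUpToIso_hom
      (colimit.isColimit (D ⋙ F ⋙ Ind.yoneda)) i
    have h2 := (isColimitExtendCocone (G ⋙ Ind.yoneda) hc).comp_coconePointUniqueUpToIso_hom
      (colimit.isColimit (D ⋙ G ⋙ Ind.yoneda)) i
    refine (((Category.assoc _ _ _).symm.trans (congrArg (· ≫ _) h)).trans (Category.assoc _ _ _)).trans ?_
    refine (congrArg _ h2).trans (Eq.trans ?_ ((Category.assoc _ _ _).symm.trans (congrArg (· ≫ _) h1)).symm)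
    exact (colimit.ι_map (F := D ⋙ F ⋙ Ind.yoneda)
      (Functor.whiskerLeft D (Functor.whiskerRight τ Ind.yoneda)) i).symm)

end

/-- Mutually inverse families of morphisms up to transition maps induce an isomorphism of
filtered colimits. -/
theorem isIso_colimMap_of_interleaving {E : Type u'} [Category.{v'} E] {J : Type u} [Category.{v} J]
    [IsFiltered J] {A B : J ⥤ E} [HasColimit A] [HasColimit B] (φ : A ⟶ B)
    (h : ∀ j, ∃ (k : J) (f : j ⟶ k) (s : B.obj j ⟶ A.obj k),
      φ.app j ≫ s = A.map f ∧ s ≫ φ.app k = B.map f) : IsIso (colimMap φ) := by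
  choose k f s hs hs' using h
  have h1 : ∀ j, φ.app j ≫ s j ≫ colimit.ι A (k j) = colimit.ι A j := fun j => by
    rw [reassoc_of% hs j, colimit.w]
  -- The `s j` are chosen separately and need not be natural. They agree in the colimit: by `h1`
  -- each `colimit.ι A` factors through `φ`, and after composition with `φ` both sides become
  -- transition maps of `B`, made equal by `q`.
  have key : ∀ {j l : J} (g : j ⟶ l), B.map g ≫ s l ≫ colimit.ι A (k l) =
      s j ≫ colimit.ι A (k j) := by
    intro j l g
    let m := IsFiltered.max (k j) (k l)
    let a : k j ⟶ m := IsFiltered.leftToMax _ _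
    let b : k l ⟶ m := IsFiltered.rightToMax _ _
    let q := IsFiltered.coeqHom (f j ≫ a) (g ≫ f l ≫ b)
    have hq := IsFiltered.coeq_condition (f j ≫ a) (g ≫ f l ≫ b)
    have e1 : s j ≫ A.map (a ≫ q) ≫ φ.app _ = B.map (f j ≫ a ≫ q) := by
      rw [φ.naturality, reassoc_of% hs' j, ← B.map_comp]
    have e2 : (B.map g ≫ s l ≫ A.map (b ≫ q)) ≫ φ.app _ = B.map (g ≫ f l ≫ b ≫ q) := by
      simp only [Category.assoc]
      rw [φ.naturality, reassoc_of% hs' l, ← B.map_comp, ← B.map_comp]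
    have e3 : f j ≫ a ≫ q = g ≫ f l ≫ b ≫ q := by simpa using hq
    rw [← colimit.w A (a ≫ q), ← colimit.w A (b ≫ q), ← h1, reassoc_of% e1, e3,
      ← e2]
    simp only [Category.assoc]
  refine ⟨colimit.desc B ⟨_, { app := fun j => s j ≫ colimit.ι A (k j), naturality := ?_ }⟩, ?_, ?_⟩
  · intro j l g
    simpa using key g
  · ext j
    simp [h1]
  · ext j
    simp [reassoc_of% hs' j]

end IndExt

theorem isIso_of_isLimit_kernelFork.{v, u} {E : Type u} [Category.{v} E] [HasZeroMorphisms E]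
    {X X' Y Z : E} {f : X ⟶ Y} {f' : X' ⟶ Y} {g : Y ⟶ Z} {w : f ≫ g = 0} {w' : f' ≫ g = 0}
    (h : IsLimit (KernelFork.ofι f w)) (h' : IsLimit (KernelFork.ofι f' w')) (p : X ⟶ X')
    (hp : p ≫ f' = f) : IsIso p := by
  have hu : p = (h.conePointUniqueUpToIso h').hom := by
    refine Fork.IsLimit.hom_ext h' (hp.trans ?_)
    exact (h.conePointUniqueUpToIso_hom_comp h' WalkingParallelPair.zero).symm
  rw [hu]
  infer_instance

theorem IsKernelMap.of_isIso_comp.{v, u} {E : Type u} [Category.{v} E] [HasZeroMorphisms E]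
    {X X' Y : E} {f : X ⟶ Y} {f' : X' ⟶ Y} (hf : IsKernelMap f) (p : X' ⟶ X) [IsIso p]
    (hp : p ≫ f = f') : IsKernelMap f' :=
  hf.of_arrow_iso (Arrow.isoMk (asIso p).symm (Iso.refl _) (by simp [← hp]))

/-! ### Kernels of ind-objects -/

namespace IndExt

universe v u

variable {C : Type u} [Category.{v} C]

/-- Filtered colimits commute with finite limits in presheaves of types; this transfers along the
inclusion, which preserves filtered colimits and reflects equalizers. -/
instance preservesEqualizers_colim [HasEqualizers C] {I : Type v} [SmallCategory I] [IsFiltered I] :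
    PreservesLimitsOfShape WalkingParallelPair (colim : (I ⥤ Ind C) ⥤ Ind C) :=
  haveI : PreservesLimitsOfShape WalkingParallelPair
      ((colim : (I ⥤ Ind C) ⥤ Ind C) ⋙ Ind.inclusion C) :=
    preservesLimitsOfShape_of_natIso (preservesColimitNatIso (J := I) (Ind.inclusion C)).symm
  preservesLimitsOfShape_of_reflects_of_preserves _ (Ind.inclusion C)

/-- The equality `c.pt = V`, instead of an isomorphism, lets `V` be replaced by the cocone point. -/
theorem exists_presentation (V : Ind C) : ∃ (J : Type v) (_ : SmallCategory J) (_ : IsFiltered J)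
    (D : J ⥤ C) (c : Cocone (D ⋙ Ind.yoneda)), Nonempty (IsColimit c) ∧ c.pt = V :=
  ⟨_, inferInstance, inferInstance, V.presentation.F,
    (colimit.cocone _).extend V.colimitPresentationCompYoneda.hom,
    ⟨(colimit.isColimit _).extendIso _⟩, rfl⟩

variable [HasZeroMorphisms C] [HasZeroMorphisms (Ind C)] [HasEqualizers C] [HasCoequalizers C]

instance preservesZeroMorphisms_lim {I : Type v} [SmallCategory I] [IsFiltered I] :
    (Ind.lim I : (I ⥤ C) ⥤ Ind C).PreservesZeroMorphisms :=
  inferInstanceAs ((Functor.whiskeringRight _ _ _).obj Ind.yoneda ⋙ colim).PreservesZeroMorphisms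

/-- A functor on `Ind C` which is compatible with filtered colimits preserves kernels if it does so
for kernels in `C`. -/
theorem isKernelMap_map (G : Ind C ⥤ Ind C)
    (hG : ∀ (I : Type v) [SmallCategory I] [IsFiltered I] (D : I ⥤ C),
      PreservesColimit (D ⋙ Ind.yoneda) G)
    (h : ∀ {X Y : C} (f : X ⟶ Y), IsKernelMap f → IsKernelMap (G.map (Ind.yoneda.map f)))
    {X Y : Ind C} {f : X ⟶ Y} (hf : IsKernelMap f) : IsKernelMap (G.map f) := by
  obtain ⟨I, _, _, A, B, φ, ⟨e⟩⟩ := Ind.exists_nonempty_arrow_mk_iso_ind_lim (f := f)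
  obtain ⟨Z, g, w, ⟨hφ⟩⟩ := hf.of_arrow_iso e
  -- `φ` presents a kernel but need not be a kernel at each level, whereas `κ` is. Since `Ind.lim I`
  -- preserves kernels and cokernels, `"colim" φ` and `"colim" κ` are kernels of the same map.
  let κ := kernel.ι (cokernel.π φ)
  have hκ := KernelFork.mapIsLimit _ (kernelIsKernel (cokernel.π φ)) (Ind.lim I)
  have hq := CokernelCofork.mapIsColimit _ (cokernelIsCokernel φ) (Ind.lim I)
  have hφ' := IsKernelMap.isLimitOfIsColimit hφ hq
    (wq := by rw [← Functor.map_comp]; simp)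
  have hi : IsIso ((Ind.lim I).map (Abelian.factorThruImage φ)) :=
    isIso_of_isLimit_kernelFork hφ' hκ (w' := by rw [← Functor.map_comp]; simp) _
      (((Ind.lim I).map_comp _ _).symm.trans (congrArg _ (Abelian.image.fac φ)))
  have hG' := hG I
  have hm : IsKernelMap (colim.map (Functor.whiskerRight κ (Ind.yoneda ⋙ G))) := by
    refine (IsKernelMap.of_app _ fun i => h _ ?_).map colim
    exact (IsKernelMap.kernel_ι (cokernel.π φ)).map ((evaluation I C).obj i)
  -- `G` commutes with both colimits, which identifies this map with the one in `hm`.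
  have hκG : IsKernelMap (G.map ((Ind.lim I).map κ)) := by
    refine hm.of_arrow_iso (Arrow.isoMk
      (preservesColimitIso G (kernel (cokernel.π φ) ⋙ Ind.yoneda)).symm
      (preservesColimitIso G (B ⋙ Ind.yoneda)).symm ?_)
    refine colimit.hom_ext fun i => ?_
    have h1 := ι_preservesColimitIso_inv G (kernel (cokernel.π φ) ⋙ Ind.yoneda) i
    have h2 := ι_preservesColimitIso_inv G (B ⋙ Ind.yoneda) i
    have h3 := colimit.ι_map (Functor.whiskerRight κ (Ind.yoneda ⋙ G)) i
    have h4 := colimit.ι_map (Functor.whiskerRight κ Ind.yoneda) i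
    refine ((Category.assoc _ _ _).symm.trans (congrArg (· ≫ _) h1)).trans ?_
    refine Eq.trans ?_ ((Category.assoc _ _ _).symm.trans (congrArg (· ≫ _) h3)).symm
    refine Eq.trans ?_ ((Category.assoc _ _ _).trans (congrArg (_ ≫ ·) h2)).symm
    exact (G.map_comp _ _).symm.trans ((congrArg G.map h4).trans (G.map_comp _ _))
  refine (hκG.of_isIso_comp (G.map ((Ind.lim I).map (Abelian.factorThruImage φ)))
    (f' := G.map ((Ind.lim I).map φ)) ?_).of_arrow_iso (G.mapArrow.mapIso e.symm)
  rw [← Functor.map_comp, ← Functor.map_comp, Abelian.image.fac]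

/-- A criterion for `"colim" uⱼ` to be a kernel: up to transition maps, `uⱼ` agrees with the kernel
of its cokernel. -/
theorem isKernelMap_lim_map {J : Type v} [SmallCategory J] [IsFiltered J] {A B : J ⥤ C} (u : A ⟶ B)
    (h : ∀ j, ∃ (k : J) (f : j ⟶ k), ∀ (K : C) (ι : K ⟶ B.obj j) (t : A.obj j ⟶ K),
      (∀ (Z : C) (q : B.obj j ⟶ Z), u.app j ≫ q = 0 → ι ≫ q = 0) → t ≫ ι = u.app j →
      ∃ s : K ⟶ A.obj k, t ≫ s = A.map f ∧ s ≫ u.app k = ι ≫ B.map f) :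
    IsKernelMap ((Ind.lim J).map u) := by
  have hfac := Abelian.image.fac u
  have hi : IsIso ((Ind.lim J).map (Abelian.factorThruImage u)) := by
    refine isIso_colimMap_of_interleaving _ fun j => ?_
    obtain ⟨k, f, hs⟩ := h j
    -- The hypothesis is applied to the kernel of the cokernel at level `j`. Cokernels are
    -- pointwise, so every `q` killing `u.app j` factors through `(cokernel.π u).app j` and kills
    -- this kernel.
    obtain ⟨s, hs₁, hs₂⟩ := hs _ ((Abelian.image.ι u).app j) ((Abelian.factorThruImage u).app j)
      (fun Z q hq => by
        have hc := CokernelCofork.mapIsColimit _ (cokernelIsCokernel u) ((evaluation J C).obj j)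
        have h1 := hc.fac (CokernelCofork.ofπ q hq) WalkingParallelPair.one
        refine (congrArg (_ ≫ ·) h1.symm).trans ?_
        have h2 := congr_app (kernel.condition (cokernel.π u)) j
        refine (Category.assoc _ _ _).symm.trans ((congrArg (· ≫ _) h2).trans zero_comp))
      (congr_app hfac j)
    refine ⟨k, f, Ind.yoneda.map s, ?_, ?_⟩
    · exact (Ind.yoneda.map_comp _ _).symm.trans (congrArg _ hs₁)
    · refine (Ind.yoneda.map_comp _ _).symm.trans (congrArg Ind.yoneda.map ?_)
      have : Mono ((Abelian.image.ι u).app k) := mono_of_isLimit_fork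
        (KernelFork.mapIsLimit _ (kernelIsKernel (cokernel.π u)) ((evaluation J C).obj k))
      rw [← cancel_mono ((Abelian.image.ι u).app k), Category.assoc]
      refine (congrArg (s ≫ ·) (congr_app hfac k)).trans (hs₂.trans ?_)
      exact ((Abelian.image.ι u).naturality f).symm
  exact ((IsKernelMap.kernel_ι (cokernel.π u)).map (Ind.lim J)).of_isIso_comp
    ((Ind.lim J).map (Abelian.factorThruImage u))
    (((Ind.lim J).map_comp _ _).symm.trans (congrArg _ hfac))

end IndExt

/-! ### Banach modules: contractions and lifting along tensors -/

namespace BanMod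

universe u

variable {R : Type u} [BanachRing R]

/-- The bounded map `R → M`, `r ↦ r m`. -/
def ofElement {M : BanMod R} (m : M) : HomSpace (unit R) M :=
  HomSpace.mk (M := unit R) (LinearMap.toSpanSingleton R M m) (by
    obtain ⟨C, -, h⟩ := M.exists_norm_smul_le
    refine ⟨C * ‖m‖, fun r => (h r m).trans (le_of_eq (by ring))⟩)

theorem ofElement_one {M : BanMod R} (m : M) : ofElement m (show unit R from (1 : R)) = m :=
  one_smul R m

theorem comp_ofElement {M N : BanMod R} (f : HomSpace M N) (m : M) :
    HomSpace.comp f (ofElement m) = ofElement (f m) :=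
  HomSpace.ext fun r => f.map_smul (show R from r) m

/-- Elements of `M` are bounded maps `R → M`, and these can be cancelled against `f`. -/
theorem injective_of_mono {M N : BanMod R} (f : M ⟶ N) [Mono f] :
    Function.Injective (show HomSpace M N from f) := by
  intro x y hxy
  have h : (ofElement x : unit R ⟶ M) = ofElement y := by
    rw [← cancel_mono f]
    exact (comp_ofElement f x).trans ((congrArg ofElement hxy).trans (comp_ofElement f y).symm)
  rw [← ofElement_one x, ← ofElement_one y]
  exact DFunLike.congr_fun (F := HomSpace (unit R) M) h _

/-- The kernel of a bounded map, as a closed submodule. -/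
def kerObj {M N : BanMod R} (f : HomSpace M N) : BanMod R :=
  have hc : IsClosed (LinearMap.ker f.1 : Set M) := by
    have : (LinearMap.ker f.1 : Set M) = f ⁻¹' {0} := by ext; rfl
    rw [this]
    exact isClosed_singleton.preimage f.continuous
  have : CompleteSpace (LinearMap.ker f.1) := hc.completeSpace_coe
  { carrier := LinearMap.ker f.1
    exists_norm_smul_le := by
      obtain ⟨C, hC, h⟩ := M.exists_norm_smul_le
      exact ⟨C, hC, fun a m => h a m⟩ }

/-- A kernel in the category of Banach modules is bounded below. -/
theorem exists_norm_le_of_isKernelMap {M N : BanMod R} {f : M ⟶ N} (hf : IsKernelMap f) :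
    ∃ C : ℝ, 0 ≤ C ∧ ∀ m : M, ‖m‖ ≤ C * ‖(show HomSpace M N from f) m‖ := by
  obtain ⟨P, g, w, ⟨h⟩⟩ := hf
  have : Mono f := mono_of_isLimit_fork h
  let i : kerObj g ⟶ N := HomSpace.mk (M := kerObj g) (LinearMap.ker (show HomSpace N P from g).1).subtype
    ⟨1, fun m => (one_mul ‖m‖).ge⟩
  have hi : i ≫ g = 0 := HomSpace.ext fun m => m.2
  -- The universal property, tested on the concrete kernel with the norm of `N`, yields a bounded
  -- inverse of `f` on its image. No open mapping theorem is involved.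
  let s : HomSpace (kerObj g) M := h.lift (KernelFork.ofι i hi)
  have hs : ∀ y : kerObj g, (show HomSpace M N from f) (s y) = y.1 :=
    DFunLike.congr_fun (F := HomSpace (kerObj g) N)
      (h.fac (KernelFork.ofι i hi) WalkingParallelPair.zero)
  obtain ⟨C, hC, hb⟩ := s.exists_bound
  refine ⟨C, hC, fun m => ?_⟩
  let y : kerObj g := ⟨(show HomSpace M N from f) m, DFunLike.congr_fun (F := HomSpace M P) w m⟩
  have hy : s y = m := injective_of_mono f (hs y)
  exact (congrArg _ hy.symm).trans_le (hb y)

/-- The explicit constant is what makes `tensorLeft` and `contract` bounded in their argument. -/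
theorem norm_tensorLift_le {M N P : BanMod R} (b : M →ₗ[R] N →ₗ[R] P) {C : ℝ} (hC : 0 ≤ C)
    (hb : ∀ m n, ‖b m n‖ ≤ C * (‖m‖ * ‖n‖)) : ‖tensorLift b ⟨C, hC, hb⟩‖ ≤ C := by
  refine HomSpace.norm_le hC fun x => ?_
  refine UniformSpace.Completion.induction_on
    (p := fun x => ‖tensorLift b ⟨C, hC, hb⟩ x‖ ≤ C * ‖x‖) x ?_ fun x => ?_
  · exact isClosed_le (HomSpace.continuous (tensorLift b ⟨C, hC, hb⟩)).norm (continuous_const.mul continuous_norm)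
  · rw [UniformSpace.Completion.norm_coe]
    refine (congrArg norm (NormedAddGroupHom.extension_coe _ x)).trans_le ?_
    exact AlgTensor.bound_of_tmul (TensorProduct.lift b).toAddMonoidHom hC hb x

/-- The bounded map `m ↦ m ⊗ n`. -/
def tmulRight (M : BanMod R) {N : BanMod R} (n : N) : HomSpace M (tensorObj M N) :=
  HomSpace.mk ((tmulₗ M N).flip n) ⟨‖n‖, fun m => (norm_tmul_le m n).trans (mul_comm _ _).le⟩

/-- The bounded map `n ↦ m ⊗ n`. -/
def tmulLeft {M : BanMod R} (N : BanMod R) (m : M) : HomSpace N (tensorObj M N) :=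
  HomSpace.mk (tmulₗ M N m) ⟨‖m‖, fun n => norm_tmul_le m n⟩

/-- Evaluation at an element, as a bounded map. -/
def evalAt {M : BanMod R} (N : BanMod R) (m : M) : HomSpace (homObj M N) N :=
  HomSpace.mk (M := homObj M N)
    { toFun := fun f : HomSpace M N => f m
      map_add' := fun _ _ => rfl
      map_smul' := fun _ _ => rfl }
    ⟨‖m‖, fun f : HomSpace M N => (f.le_norm m).trans (mul_comm _ _).le⟩

/-- The bounded map `g ↦ id ⊗ g`. -/
def tensorLeft (M N P : BanMod R) :
    HomSpace (homObj N P) (homObj (tensorObj M N) (tensorObj M P)) :=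
  HomSpace.mk (M := homObj N P) (N := homObj (tensorObj M N) (tensorObj M P))
    { toFun := fun g : HomSpace N P => tensorMap (HomSpace.id M) g
      map_add' := fun (g h : HomSpace N P) => tensor_hom_ext fun m n => by
        change _ = tensorMap (HomSpace.id M) g (tmul m n) + tensorMap (HomSpace.id M) h (tmul m n)
        simp only [tensorMap_tmul]
        exact map_add (tmulₗ M P m) (g n) (h n)
      map_smul' := fun a (g : HomSpace N P) => tensor_hom_ext fun m n => by
        change _ = a • tensorMap (HomSpace.id M) g (tmul m n)
        simp only [tensorMap_tmul]
        exact (tmulₗ M P m).map_smul a (g n) }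
    ⟨1, fun g : HomSpace N P => by
      rw [one_mul]
      exact norm_tensorLift_le ((tmulₗ M P).compl₁₂ (HomSpace.id M).1 g.1) g.nonneg fun m n =>
        (norm_tmul_le m (g n)).trans (by
          calc ‖m‖ * ‖g n‖ ≤ ‖m‖ * (‖g‖ * ‖n‖) := by gcongr; exact g.le_norm n
            _ = ‖g‖ * (‖m‖ * ‖n‖) := by ring)⟩

/-- The bilinear map `(m, n) ↦ α(n) m`. -/
def contractBilin (M : BanMod R) {N : BanMod R} (α : HomSpace N (unit R)) : M →ₗ[R] N →ₗ[R] M :=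
  LinearMap.mk₂ R (fun m n => (show R from α n) • m)
    (fun m m' n => smul_add (show R from α n) m m')
    (fun a m n => smul_comm (show R from α n) a m)
    (fun m n n' => (congrArg (fun r : R => r • m) (map_add α n n')).trans (add_smul _ _ m))
    (fun a m n => (congrArg (fun r : R => r • m) (α.map_smul a n)).trans (mul_smul a _ m))

theorem exists_norm_contractBilin_le (M N : BanMod R) :
    ∃ C : ℝ, 0 ≤ C ∧ ∀ (α : HomSpace N (unit R)) (m : M) (n : N),
      ‖contractBilin M α m n‖ ≤ C * ‖α‖ * (‖m‖ * ‖n‖) := by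
  obtain ⟨C, hC, h⟩ := M.exists_norm_smul_le
  refine ⟨C, hC.le, fun α m n => (h (α n) m).trans ?_⟩
  calc C * ‖α n‖ * ‖m‖ ≤ C * (‖α‖ * ‖n‖) * ‖m‖ := by gcongr; exact α.le_norm n
    _ = _ := by ring

/-- The contraction `M ⊗ N → M`, `m ⊗ n ↦ α(n) m`. -/
def contractBy (M : BanMod R) {N : BanMod R} (α : HomSpace N (unit R)) :
    HomSpace (tensorObj M N) M :=
  tensorLift (contractBilin M α) (by
    obtain ⟨C, hC, h⟩ := exists_norm_contractBilin_le M N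
    exact ⟨C * ‖α‖, mul_nonneg hC α.nonneg, h α⟩)

theorem contractBy_tmul {M N : BanMod R} (α : HomSpace N (unit R)) (m : M) (n : N) :
    contractBy M α (tmul m n) = (show R from α n) • m :=
  tensorLift_tmul _ _ m n

/-- The contraction `M ⊗ N → M` as a bounded function of the functional on `N`. -/
def contract (M N : BanMod R) : HomSpace (dual N) (homObj (tensorObj M N) M) :=
  HomSpace.mk (M := dual N) (N := homObj (tensorObj M N) M)
    { toFun := fun α : HomSpace N (unit R) => contractBy M α
      map_add' := fun (α β : HomSpace N (unit R)) => tensor_hom_ext fun m n =>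
        (contractBy_tmul _ m n).trans <| (add_smul (show R from α n) (show R from β n) m).trans
          (congrArg₂ (· + ·) (contractBy_tmul α m n) (contractBy_tmul β m n)).symm
      map_smul' := fun a (α : HomSpace N (unit R)) => tensor_hom_ext fun m n =>
        (contractBy_tmul _ m n).trans <| (mul_smul a (show R from α n) m).trans
          (congrArg (a • ·) (contractBy_tmul α m n)).symm }
    (by
      obtain ⟨C, hC, h⟩ := exists_norm_contractBilin_le M N
      exact ⟨C, fun α : HomSpace N (unit R) =>
        norm_tensorLift_le (contractBilin M α) (mul_nonneg hC α.nonneg) (h α)⟩)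

/-- A rank one map tensored with `M` factors through `M` itself. With `M = Y`, this is where the
kernel property of `X → Y` can be applied, before tensoring again. -/
theorem tensorMap_rankOne (M : BanMod R) {N P : BanMod R} (α : HomSpace N (unit R)) (p : P) :
    tensorMap (HomSpace.id M) (rankOne α p) = HomSpace.comp (tmulRight M p) (contractBy M α) :=
  tensor_hom_ext fun m n => by
    rw [tensorMap_tmul, HomSpace.comp_apply, contractBy_tmul, rankOne_apply]
    exact ((tmulₗ M P m).map_smul (show R from α n) p).trans
      ((tmulₗ M P).map_smul₂ (show R from α n) m p).symm

/-- Let `f : X → Y` be a kernel of Banach modules, let `K → Y ⊗ W` be a map lying in the closure of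
the image of `X ⊗ W`, and let `t ∈ W^∨ ⊗ V`. Then the map `K → Y ⊗ W → Y ⊗ V` induced by `t` lifts
to `X ⊗ V`. -/
theorem exists_lift_of_tensor {X Y W V K : BanMod R} {f : X ⟶ Y} (hf : IsKernelMap f)
    (ι : K ⟶ tensorObj Y W) (τ : tensorObj X W ⟶ K)
    (hι : ∀ (Z : BanMod R) (q : tensorObj Y W ⟶ Z), ((tensor R).map f).app W ≫ q = 0 → ι ≫ q = 0)
    (hτ : τ ≫ ι = ((tensor R).map f).app W) (t : tensorObj (dual W) V) :
    ∃ s : K ⟶ tensorObj X V, τ ≫ s = ((tensor R).obj X).map (dualTensorHom W V t) ∧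
      s ≫ ((tensor R).map f).app V = ι ≫ ((tensor R).obj Y).map (dualTensorHom W V t) := by
  obtain ⟨C, hC, hfC⟩ := exists_norm_le_of_isKernelMap hf
  obtain ⟨Z, g, w, ⟨hk⟩⟩ := hf
  have : Mono f := mono_of_isLimit_fork hk
  have hinj := injective_of_mono f
  let f' : HomSpace X Y := f
  let ι' : HomSpace K (tensorObj Y W) := ι
  let τ' : HomSpace (tensorObj X W) K := τ
  -- On the image of `X ⊗ W` this reads `g (α(w) f(x)) = 0`; `hι` extends it to `K`. So contraction
  -- by `α` carries `K` into the kernel `X` of `g`.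
  have hg (α : HomSpace W (unit R)) : (ι ≫ contractBy Y α) ≫ g = 0 := by
    rw [Category.assoc]
    refine hι Z _ (tensor_hom_ext fun x w' => ?_)
    change (show HomSpace Y Z from g) (contractBy Y α (tensorMap f' (HomSpace.id W) (tmul x w'))) = 0
    rw [tensorMap_tmul, contractBy_tmul, HomSpace.map_smul]
    exact (congrArg _ (DFunLike.congr_fun (F := HomSpace X Z) w x)).trans (smul_zero _)
  have hρ (α : HomSpace W (unit R)) : ∃ ρ : HomSpace K X, ∀ k, f' (ρ k) = contractBy Y α (ι' k) :=
    ⟨hk.lift (KernelFork.ofι _ (hg α)), DFunLike.congr_fun (F := HomSpace K Y)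
      (hk.fac (KernelFork.ofι _ (hg α)) WalkingParallelPair.zero)⟩
  choose ρ hρ using hρ
  -- The lifts `ρ α` are chosen one by one; injectivity of `f` makes them linear in `α`.
  let b : dual W →ₗ[R] V →ₗ[R] homObj K (tensorObj X V) := LinearMap.mk₂ R
    (fun (α : HomSpace W (unit R)) (v : V) =>
      (HomSpace.comp (tmulRight X v) (ρ α) : HomSpace K (tensorObj X V)))
    (fun (α β : HomSpace W (unit R)) v => HomSpace.ext fun k => by
      have : ρ (α + β) k = ρ α k + ρ β k := hinj (by
        change f' _ = f' _
        rw [map_add, hρ, hρ, hρ]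
        exact DFunLike.congr_fun (F := HomSpace (tensorObj Y W) Y)
          (map_add (contract Y W) α β) (ι' k))
      exact (congrArg (tmulRight X v) this).trans (map_add _ _ _))
    (fun a (α : HomSpace W (unit R)) v => HomSpace.ext fun k => by
      have : ρ (a • α) k = a • ρ α k := hinj (by
        change f' _ = f' _
        rw [HomSpace.map_smul, hρ, hρ]
        exact DFunLike.congr_fun (F := HomSpace (tensorObj Y W) Y)
          ((contract Y W).map_smul a α) (ι' k))
      exact (congrArg (tmulRight X v) this).trans (HomSpace.map_smul _ _ _))
    (fun (α : HomSpace W (unit R)) v v' => HomSpace.ext fun k => map_add (tmulₗ X V (ρ α k)) v v')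
    (fun a (α : HomSpace W (unit R)) v => HomSpace.ext fun k =>
      (tmulₗ X V (ρ α k)).map_smul a v)
  -- `C` bounds the inverse of `f` on its image, so the norm of `ρ α k` is controlled linearly by
  -- that of `α`. This lets `b` extend to the completed tensor product.
  have hρn (α : HomSpace W (unit R)) (k : K) : ‖ρ α k‖ ≤ C * (‖contract Y W‖ * ‖α‖ * (‖ι'‖ * ‖k‖)) := by
    refine (hfC _).trans (mul_le_mul_of_nonneg_left ?_ hC)
    refine (congrArg norm (hρ α k)).trans_le ((HomSpace.le_norm _ _).trans ?_)
    exact mul_le_mul ((contract Y W).le_norm α) (ι'.le_norm k) (norm_nonneg _)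
      (mul_nonneg (norm_nonneg _) α.nonneg)
  let S : HomSpace (tensorObj (dual W) V) (homObj K (tensorObj X V)) := tensorLift b
    ⟨C * ‖contract Y W‖ * ‖ι'‖, by positivity, fun (α : HomSpace W (unit R)) v => by
      have hα := α.nonneg
      refine HomSpace.norm_le (mul_nonneg (by positivity) (mul_nonneg hα (norm_nonneg _)))
        fun k => ?_
      refine (norm_tmul_le (ρ α k) v).trans ?_
      refine (mul_le_mul_of_nonneg_right (hρn α k) (norm_nonneg v)).trans (le_of_eq ?_)
      change _ = _ * _ * _ * (‖α‖ * _) * _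
      ring⟩
  have hS (α : HomSpace W (unit R)) (v : V) (k : K) :
      evalAt (tensorObj X V) k (S (tmul (M := dual W) α v)) = tmul (ρ α k) v :=
    DFunLike.congr_fun (F := HomSpace K (tensorObj X V))
      (tensorLift_tmul (M := dual W) (P := homObj K (tensorObj X V)) b _ α v) k
  -- Both identities are bounded and linear in `t`, hence need checking only for `t = α ⊗ v`. The
  -- first then says `α(w) x ⊗ v = x ⊗ α(w) v`; the second is `tensorMap_rankOne`.
  refine ⟨S t, tensor_hom_ext fun x w' => ?_, HomSpace.ext fun k => ?_⟩
  · have key : HomSpace.comp (evalAt (tensorObj X V) (τ' (tmul x w'))) S =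
        HomSpace.comp (tmulLeft V x) (HomSpace.comp (evalAt V w') (dualTensorHom W V)) := by
      refine tensor_hom_ext fun (α : HomSpace W (unit R)) v => ?_
      refine (hS α v _).trans ?_
      have h1 : ρ α (τ' (tmul x w')) = (show R from α w') • x := hinj (by
        change f' _ = f' _
        rw [hρ, HomSpace.map_smul]
        have h2 : ι' (τ' (tmul x w')) = tmul (f' x) w' :=
          (DFunLike.congr_fun (F := HomSpace (tensorObj X W) (tensorObj Y W)) hτ (tmul x w')).trans
            (tensorMap_tmul _ _ _ _)
        rw [h2, contractBy_tmul])
      rw [h1]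
      refine ((tmulₗ X V).map_smul₂ (show R from α w') x v).trans ?_
      refine ((tmulₗ X V x).map_smul (show R from α w') v).symm.trans ?_
      exact congrArg (fun h : HomSpace W V => tmul x (h w')) (dualTensorHom_tmul W V α v).symm
    refine (DFunLike.congr_fun key t).trans ?_
    exact (tensorMap_tmul (HomSpace.id X) (show HomSpace W V from dualTensorHom W V t) x w').symm
  · have key : HomSpace.comp (tensorMap f' (HomSpace.id V))
          (HomSpace.comp (evalAt (tensorObj X V) k) S) =
        HomSpace.comp (evalAt (tensorObj Y V) (ι' k))
          (HomSpace.comp (tensorLeft Y W V) (dualTensorHom W V)) := by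
      refine tensor_hom_ext fun (α : HomSpace W (unit R)) v => ?_
      refine (congrArg (tensorMap f' (HomSpace.id V)) (hS α v k)).trans ?_
      rw [tensorMap_tmul, hρ]
      refine (DFunLike.congr_fun (tensorMap_rankOne Y α v) (ι' k)).symm.trans ?_
      exact congrArg (fun h : HomSpace W V => tensorMap (HomSpace.id Y) h (ι' k))
        (dualTensorHom_tmul W V α v).symm
    exact DFunLike.congr_fun key t

end BanMod

/-! ### Nuclear ind-Banach modules are flat -/

namespace IndBan

universe u

variable {R : Type u} [BanachRing R]

/-- A nuclear ind-Banach module has a presentation whose transition maps eventually come from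
elements of completed tensor products `Dⱼ^∨ ⊗ Dₖ`. -/
theorem IsNuclear.exists_dualTensorHom_eq {J : Type u} [SmallCategory J] [IsFiltered J]
    {D : J ⥤ BanMod R} {c : Cocone (D ⋙ Ind.yoneda)} (hc : IsColimit c) (hV : IsNuclear c.pt)
    (j : J) : ∃ (k : J) (f : j ⟶ k) (t : BanMod.tensorObj (BanMod.dual (D.obj j)) (D.obj k)),
      BanMod.dualTensorHom (D.obj j) (D.obj k) t = D.map f := by
  let W := D.obj j
  let φ := Functor.whiskerLeft D (BanMod.dualTensorHomNat W)
  have h1 : IsIso ((IndExt.extendEndo.map (BanMod.dualTensorHomNat W)).app c.pt) := by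
    have h := hV W
    have : IsIso ((IndExt.extendBiIso (BanMod.tensor R) (BanMod.dual W)).hom.app c.pt) :=
      inferInstance
    exact @IsIso.of_isIso_comp_left _ _ _ _ _
      ((IndExt.extendBiIso (BanMod.tensor R) (BanMod.dual W)).hom.app c.pt) _ this h
  have h2 : IsIso ((Ind.lim J).map φ) :=
    (NatIso.isIso_map_iff (IndExt.extendEndoObjIso hc) (BanMod.dualTensorHomNat W)).1 h1
  let hA := colimit.isColimit ((D ⋙ (BanMod.tensor R).obj (BanMod.dual W)) ⋙ Ind.yoneda)
  let hB := colimit.isColimit ((D ⋙ BanMod.ihom W) ⋙ Ind.yoneda)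
  -- Ind-objects have no elements, so the identity of `W = D.obj j` is encoded as a map from `R`.
  let one : BanMod.unit R ⟶ (D ⋙ BanMod.ihom W).obj j :=
    BanMod.ofElement (M := BanMod.homObj W W) (BanMod.HomSpace.id W)
  let a : Ind.yoneda.obj (BanMod.unit R) ⟶ (Ind.lim J).obj (D ⋙ BanMod.ihom W) :=
    Ind.yoneda.map one ≫ colimit.ι ((D ⋙ BanMod.ihom W) ⋙ Ind.yoneda) j
  obtain ⟨b, hb⟩ : ∃ b, b ≫ (Ind.lim J).map φ = a :=
    ⟨a ≫ (asIso ((Ind.lim J).map φ)).inv, (Category.assoc _ _ _).trans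
      ((congrArg (a ≫ ·) (asIso ((Ind.lim J).map φ)).inv_hom_id).trans (Category.comp_id a))⟩
  -- Finite presentability of `R` realizes the preimage at a stage `k`; it maps to the identity only
  -- in the colimit, so a later stage `l` is needed below for equality.
  obtain ⟨k, p, hp⟩ := IsFinitelyPresentable.exists_hom_of_isColimit hA b
  obtain ⟨p, rfl⟩ := Ind.yoneda.map_surjective p
  have h3 : Ind.yoneda.map (p ≫ φ.app k) ≫ colimit.ι ((D ⋙ BanMod.ihom W) ⋙ Ind.yoneda) k = a := by
    have h4 := colimit.ι_map (Functor.whiskerRight φ Ind.yoneda) k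
    have h5 := congrArg (· ≫ (Ind.lim J).map φ) hp
    refine Eq.trans ?_ (h5.trans hb)
    refine ((congrArg (· ≫ _) (Ind.yoneda.map_comp _ _)).trans (Category.assoc _ _ _)).trans ?_
    exact (congrArg (Ind.yoneda.map p ≫ ·) h4.symm).trans (Category.assoc _ _ _).symm
  obtain ⟨l, u, v, h⟩ := IsFinitelyPresentable.exists_eq_of_isColimit hB _ _ h3
  have h' : (p ≫ φ.app k) ≫ (D ⋙ BanMod.ihom W).map u = one ≫ (D ⋙ BanMod.ihom W).map v :=
    Ind.yoneda.map_injective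
      ((Ind.yoneda.map_comp _ _).trans (h.trans (Ind.yoneda.map_comp _ _).symm))
  rw [Category.assoc, ← φ.naturality] at h'
  let t : BanMod.tensorObj (BanMod.dual W) (D.obj k) :=
    (show BanMod.HomSpace (BanMod.unit R) _ from p) (show BanMod.unit R from (1 : R))
  -- Here `u : k ⟶ l` moves the tensor to stage `l`, while `v : j ⟶ l` is the transition map it
  -- represents.
  refine ⟨l, v, BanMod.tensorMap (BanMod.HomSpace.id _) (D.map u) t, ?_⟩
  refine (DFunLike.congr_fun (F := BanMod.HomSpace (BanMod.unit R) (BanMod.homObj W (D.obj l))) h'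
    (show BanMod.unit R from (1 : R))).trans ?_
  exact congrArg (BanMod.homMap W (D.map v))
    (BanMod.ofElement_one (M := BanMod.homObj W W) (BanMod.HomSpace.id W))

/-- The criterion `IndExt.isKernelMap_lim_map` applies to `j ↦ f ⊗ Dⱼ`: the tensors representing
transition maps supply the required lifts. -/
theorem IsNuclear.isKernelMap_tensor {V : Ind (BanMod R)} (hV : IsNuclear V) {X Y : BanMod R}
    {f : X ⟶ Y} (hf : IsKernelMap f) :
    IsKernelMap (((tensor R).map (Ind.yoneda.map f)).app V) := by
  obtain ⟨J, _, _, D, c, ⟨hc⟩, rfl⟩ := IndExt.exists_presentation V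
  have h1 : IsKernelMap ((Ind.lim J).map (Functor.whiskerLeft D ((BanMod.tensor R).map f))) := by
    refine IndExt.isKernelMap_lim_map _ fun j => ?_
    obtain ⟨k, g, t, ht⟩ := hV.exists_dualTensorHom_eq hc j
    refine ⟨k, g, fun K ι τ hι hτ => ?_⟩
    have h := BanMod.exists_lift_of_tensor hf ι τ hι hτ t
    rw [ht] at h
    exact h
  have h2 := h1.of_arrow_iso (f' := (IndExt.extendEndo.map ((BanMod.tensor R).map f)).app c.pt)
    (((Functor.mapArrowFunctor _ _).mapIso (IndExt.extendEndoObjIso hc)).symm.app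
      (Arrow.mk ((BanMod.tensor R).map f)))
  exact h2.of_arrow_iso (((Functor.mapArrowFunctor _ _).mapIso
    (Functor.isoWhiskerRight (IndExt.extendIso (BanMod.tensor R ⋙ IndExt.extendEndo))
      ((evaluation _ _).obj c.pt))).app (Arrow.mk f))

/-- The tensor product is an extension in its first variable, with values in functors, and
evaluation at `V` preserves colimits of functors. -/
theorem preservesColimit_tensor (V : Ind (BanMod R)) (I : Type u) [SmallCategory I] [IsFiltered I]
    (D : I ⥤ BanMod R) :
    PreservesColimit (D ⋙ Ind.yoneda) (tensor R ⋙ (evaluation _ _).obj V) :=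
  have := IndExt.preservesColimit_extend (BanMod.tensor R ⋙ IndExt.extendEndo)
    (colimit.isColimit (D ⋙ Ind.yoneda))
  comp_preservesColimit _ _

end IndBan

theorem mainTheorem5 {R : Type*} [BanachRing R] (V : Ind (BanMod R))
    (hV : IndBan.IsNuclear V) : IndBan.IsFlat V := fun _ _ _ hf =>
  IsKernelMap.iff_isStrictMono.1 <|
    IndExt.isKernelMap_map (IndBan.tensor R ⋙ (evaluation _ _).obj V)
      (IndBan.preservesColimit_tensor V) (fun _ => hV.isKernelMap_tensor)
      (IsKernelMap.iff_isStrictMono.2 hf)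

end
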